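/- Let $R=\mathbb{Z}[z]$. For $k\ge 0$ let $A_k$ be the set of set partitions of $\{1,\dots,k,1',\dots,k'\}$, where $1,\dots,k$ is the top row and $1',\dots,k'$ the bottom row. For $\rho_1,\rho_2\in A_k$ place $\rho_1$ above $\rho_2$ and identify each vertex of the bottom row of $\rho_1$ with the corresponding vertex of the top row of $\rho_2$; let $\ell$ be the number of blocks of the resulting partition that lie entirely in the middle row, and let $\rho_1\circ\rho_2\in A_k$ be the partition that remains when the middle row is deleted. The partition algebra $\mathcal{A}_k(z)$ is the free $R$-module on $A_k$ with product $\rho_1\rho_2=z^{\ell}\,\rho_1\circ\rho_2$. Let - $s_i$ ($1\le i\le k-1$) be the partition with blocks $\{i,(i+1)'\}$, $\{i+1,i'\}$ and $\{a,a'\}$ for $a\ne i,i+1$; - $p_j$ ($1\le j\le k$) be the partition with blocks $\{j\}$, $\{j'\}$ and $\{a,a'\}$ for $a\ne j$; - $p_{i+\frac12}$ ($1\le i\le k-1$) be the partition with blocks $\{i,i+1,i',(i+1)'\}$ and $\{a,a'\}$ for $a\ne i,i+1$. Define recursively $L_0=0$, $L_1=p_1$, $\sigma_1=1$, $\sigma_2=s_1$,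 $$L_{i+1}=-s_iL_ip_{i+\frac12}-p_{i+\frac12}L_is_i+p_{i+\frac12}L_ip_{i+1}p_{i+\frac12}+s_iL_is_i+\sigma_{i+1}\qquad(i\ge1),$$ where, for $i\ge2$, $$\begin{aligned}\sigma_{i+1}={}&s_{i-1}s_i\sigma_is_is_{i-1}+s_ip_{i-\frac12}L_{i-1}s_ip_{i-\frac12}s_i+p_{i-\frac12}L_{i-1}s_ip_{i-\frac12}\\&-s_ip_{i-\frac12}L_{i-1}s_{i-1}p_{i+\frac12}p_ip_{i-\frac12}-p_{i-\frac12}p_ip_{i+\frac12}s_{i-1}L_{i-1}p_{i-\frac12}s_i,\end{aligned}$$ and $L_{\frac12}=0$, $\sigma_{\frac12}=\sigma_{1+\frac12}=1$, $$L_{i+\frac12}=-L_ip_{i+\frac12}-p_{i+\frac12}L_i+p_{i+\frac12}L_ip_ip_{i+\frac12}+s_iL_{i-\frac12}s_i+\sigma_{i+\frac12}\qquad(i\ge1),$$ where, for $i\ge2$, $$\begin{aligned}\sigma_{i+\frac12}={}&s_{i-1}s_i\sigma_{i-\frac12}s_is_{i-1}+p_{i-\frac12}L_{i-1}s_ip_{i-\frac12}s_i+s_ip_{i-\frac12}L_{i-1}s_ip_{i-\frac12}\\&-p_{i-\frac12}L_{i-1}s_{i-1}p_{i+\frac12}p_ip_{i-\frac12}-s_ip_{i-\frac12}p_ip_{i+\frac12}s_{i-1}L_{i-1}p_{i-\frac12}s_i.\end{aligned}$$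 Then in $\mathcal{A}_k(z)$ the following hold for all $i$ in the stated range and all $k\ge i+1$: 1. $L_{i+1}p_{i+\frac12}=p_{i+\frac12}L_{i+1}=p_{i+\frac12}L_ip_{i+1}p_{i+\frac12}$ for $i\ge1$; 2. $L_{i+1}p_i=p_iL_{i+1}$ for $i\ge1$; 3. $L_{i+1}p_{i-\frac12}=p_{i-\frac12}L_{i+1}$ for $i\ge2$; 4. $L_{i+1}s_{i-1}=s_{i-1}L_{i+1}$ for $i\ge2$; 5. $L_{i+1}p_{i-1}=p_{i-1}L_{i+1}$ for $i\ge2$; 6. $L_{i+\frac12}p_i=p_iL_{i+\frac12}$ for $i\ge1$; 7. $L_{i+\frac12}p_{i-\frac12}=p_{i-\frac12}L_{i+\frac12}$ for $i\ge2$; 8. $L_{i+\frac12}s_{i-1}=s_{i-1}L_{i+\frac12}$ for $i\ge2$; 9. $L_{i+\frac12}p_{i-1}=p_{i-1}L_{i+\frac12}$ for $i\ge2$. -/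

import Mathlib

namespace PartitionAlg

noncomputable section

open Polynomial

/-! ### Gluing equivalence relations -/

/-- The number of classes of `S` that contain no element of the form `j y`. -/
def missed {X Y : Type} (S : Setoid X) (j : Y → X) : ℕ :=
  Nat.card {q : Quotient S // ∀ y : Y, q ≠ Quotient.mk S (j y)}

theorem map_le_iff {X Y : Type} {r : Setoid X} {f : X → Y} {s : Setoid Y} :
    r.map f ≤ s ↔ r ≤ s.comap f := by
  constructor
  · intro h x y hxy
    exact h (Relation.EqvGen.rel _ _ ⟨x, y, hxy, rfl, rfl⟩)
  · intro h
    refine Setoid.eqvGen_le ?_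
    rintro _ _ ⟨x, y, hxy, rfl, rfl⟩
    exact h hxy

theorem map_rel {X Y : Type} {r : Setoid X} (f : X → Y) {x y : X} (h : r x y) :
    r.map f (f x) (f y) := map_le_iff.1 le_rfl h

theorem map_map {X Y Z : Type} (r : Setoid X) (f : X → Y) (g : Y → Z) :
    (r.map f).map g = r.map (g ∘ f) := by
  refine le_antisymm ?_ ?_
  · rw [map_le_iff, map_le_iff]
    intro x y h
    exact map_rel (g ∘ f) h
  · rw [map_le_iff]
    intro x y h
    exact map_rel g (map_rel f h)

theorem map_sup {X Y : Type} (r s : Setoid X) (f : X → Y) :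
    (r ⊔ s).map f = r.map f ⊔ s.map f := by
  refine le_antisymm ?_ ?_
  · rw [map_le_iff]
    refine sup_le ?_ ?_ <;> rw [← map_le_iff]
    · exact le_sup_left
    · exact le_sup_right
  · refine sup_le ?_ ?_ <;> rw [map_le_iff]
    · exact fun x y h => map_rel f ((le_sup_left : r ≤ r ⊔ s) h)
    · exact fun x y h => map_rel f ((le_sup_right : s ≤ r ⊔ s) h)

theorem map_rel_iff {X Y : Type} {r : Setoid X} {f : X → Y} (hf : Function.Injective f)
    {x y : Y} : r.map f x y ↔ x = y ∨ ∃ a b, r a b ∧ f a = x ∧ f b = y := by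
  constructor
  · intro h
    let T : Setoid Y :=
      { r := fun x y => x = y ∨ ∃ a b, r a b ∧ f a = x ∧ f b = y
        iseqv :=
          { refl := fun _ => Or.inl rfl
            symm := by
              rintro _ _ (rfl | ⟨a, b, h, rfl, rfl⟩)
              · exact Or.inl rfl
              · exact Or.inr ⟨b, a, r.symm h, rfl, rfl⟩
            trans := by
              rintro _ _ _ (rfl | ⟨a, b, h, rfl, rfl⟩) (rfl | ⟨c, d, h', h1, rfl⟩)
              · exact Or.inl rfl
              · exact Or.inr ⟨c, d, h', h1, rfl⟩
              · exact Or.inr ⟨a, b, h, rfl, rfl⟩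
              · have := hf h1
                subst this
                exact Or.inr ⟨a, d, r.trans h h', rfl, rfl⟩ } }
    have hT : r.map f ≤ T := map_le_iff.2 fun a b hab => Or.inr ⟨a, b, hab, rfl, rfl⟩
    exact hT h
  · rintro (rfl | ⟨a, b, h, rfl, rfl⟩)
    · exact (r.map f).refl _
    · exact map_rel f h

theorem glue_rel {X Y : Type} {P : Setoid X} {Q : Setoid Y} {j : Y → X} {x x' : X}
    (h : (P ⊔ Q.map j) x x') :
    P x x' ∨ ∃ y y', P x (j y) ∧ (P.comap j ⊔ Q) y y' ∧ P (j y') x' := by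
  let U := P.comap j ⊔ Q
  have hU : ∀ {y y'}, P (j y) (j y') → U y y' :=
    fun h => (le_sup_left : P.comap j ≤ U) h
  let T : Setoid X :=
    { r := fun x x' => P x x' ∨ ∃ y y', P x (j y) ∧ U y y' ∧ P (j y') x'
      iseqv :=
        { refl := fun x => Or.inl (P.refl x)
          symm := by
            rintro a b (h | ⟨y, y', h1, h2, h3⟩)
            · exact Or.inl (P.symm h)
            · exact Or.inr ⟨y', y, P.symm h3, U.symm h2, P.symm h1⟩
          trans := by
            rintro a b c (h | ⟨y, y', h1, h2, h3⟩) (h' | ⟨w, w', k1, k2, k3⟩)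
            · exact Or.inl (P.trans h h')
            · exact Or.inr ⟨w, w', P.trans h k1, k2, k3⟩
            · exact Or.inr ⟨y, y', h1, h2, P.trans h3 h'⟩
            · exact Or.inr ⟨y, w', h1, U.trans h2 (U.trans (hU (P.trans h3 k1)) k2), k3⟩ } }
  have hT : P ⊔ Q.map j ≤ T := by
    refine sup_le (fun a b h => Or.inl h) (map_le_iff.2 fun a b h => Or.inr ?_)
    exact ⟨a, b, P.refl _, (le_sup_right : Q ≤ U) h, P.refl _⟩
  exact hT h

theorem comap_glue {X Y : Type} (P : Setoid X) (Q : Setoid Y) (j : Y → X) :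
    (P ⊔ Q.map j).comap j = P.comap j ⊔ Q := by
  refine le_antisymm ?_ (sup_le ?_ ?_)
  · intro y y' h
    have hU : P.comap j ≤ P.comap j ⊔ Q := le_sup_left
    rcases glue_rel h with h | ⟨w, w', h1, h2, h3⟩
    · exact hU h
    · exact Setoid.trans' _ (hU h1) (Setoid.trans' _ h2 (hU h3))
  · exact fun y y' h => (le_sup_left : P ≤ P ⊔ Q.map j) h
  · exact map_le_iff.1 le_sup_right

theorem ne_mk_iff {X Y : Type} {S : Setoid X} {j : Y → X} {x : X} :
    (∀ y, Quotient.mk S x ≠ Quotient.mk S (j y)) ↔ ∀ y, ¬ S x (j y) :=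
  forall_congr' fun _ => not_congr Quotient.eq

theorem missed_congr {X X' Y Y' : Type} {S : Setoid X} {S' : Setoid X'} {j : Y → X} {j' : Y' → X'}
    (f : X → X')
    (h1 : ∀ x, (∀ y, ¬ S x (j y)) → ∀ y, ¬ S' (f x) (j' y))
    (h2 : ∀ x x', S x x' → S' (f x) (f x'))
    (h3 : ∀ x x', (∀ y, ¬ S x (j y)) → S' (f x) (f x') → S x x')
    (h4 : ∀ x', (∀ y, ¬ S' x' (j' y)) → ∃ x, (∀ y, ¬ S x (j y)) ∧ S' (f x) x') :
    missed S j = missed S' j' := by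
  let F : Quotient S → Quotient S' := Quotient.map f h2
  have hF : ∀ q : Quotient S, (∀ y, q ≠ Quotient.mk S (j y)) →
      ∀ y, F q ≠ Quotient.mk S' (j' y) := by
    intro q
    refine Quotient.inductionOn q ?_
    intro x hx
    exact ne_mk_iff.2 (h1 x (ne_mk_iff.1 hx))
  refine Nat.card_congr (Equiv.ofBijective (fun q => ⟨F q.1, hF q.1 q.2⟩) ⟨?_, ?_⟩)
  · rintro ⟨q, hq⟩ ⟨q', hq'⟩ h
    have h' : F q = F q' := congrArg Subtype.val h
    refine Subtype.ext ?_
    change q = q'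
    clear h hq'
    revert hq h'
    refine Quotient.inductionOn₂ q q' ?_
    intro x x' hq h'
    exact Quotient.sound (h3 x x' (ne_mk_iff.1 hq) (Quotient.exact h'))
  · rintro ⟨q, hq⟩
    revert hq
    refine Quotient.inductionOn q ?_
    intro x' hx'
    obtain ⟨x, hx, hxx⟩ := h4 x' (ne_mk_iff.1 hx')
    exact ⟨⟨Quotient.mk S x, ne_mk_iff.2 hx⟩, Subtype.ext (Quotient.sound hxx)⟩

theorem missed_glue {X Y : Type} (P : Setoid X) (Q : Setoid Y) (j : Y → X) :
    missed (P ⊔ Q.map j) j = missed P j := by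
  have hP : P ≤ P ⊔ Q.map j := le_sup_left
  symm
  refine missed_congr id ?_ (fun x x' h => hP h) ?_ ?_
  · intro x hx y h
    rcases glue_rel h with h | ⟨w, w', h1, -, -⟩
    · exact hx y h
    · exact hx w h1
  · intro x x' hx h
    rcases glue_rel h with h | ⟨w, w', h1, -, -⟩
    · exact h
    · exact absurd h1 (hx w)
  · exact fun x hx => ⟨x, fun y h => hx y (hP h), Setoid.refl' _ _⟩

theorem missed_map {X X' Y Y' : Type} (S : Setoid X) {g : X → X'} (hg : Function.Injective g)
    (j : Y → X) (j' : Y' → X') (h1 : ∀ x', (∃ x, g x = x') ∨ ∃ y, j' y = x')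
    (h2 : ∀ x, (∃ y, j' y = g x) ↔ ∃ y, j y = x) :
    missed (S.map g) j' = missed S j := by
  symm
  refine missed_congr g ?_ (fun x x' h => map_rel g h) ?_ ?_
  · intro x hx y h
    rcases (map_rel_iff hg).1 h with h | ⟨a, b, hab, ha, hb⟩
    · obtain ⟨w, rfl⟩ := (h2 x).1 ⟨y, h.symm⟩
      exact hx w (S.refl _)
    · obtain ⟨w, rfl⟩ := (h2 b).1 ⟨y, hb.symm⟩
      rw [hg ha] at hab
      exact hx w hab
  · intro x x' _ h
    rcases (map_rel_iff hg).1 h with h | ⟨a, b, hab, ha, hb⟩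
    · rw [hg h]
    · rwa [hg ha, hg hb] at hab
  · intro x' hx'
    rcases h1 x' with ⟨x, rfl⟩ | ⟨y, rfl⟩
    · refine ⟨x, fun y h => ?_, Setoid.refl' _ _⟩
      obtain ⟨w, hw⟩ := (h2 (j y)).2 ⟨y, rfl⟩
      exact hx' w (hw ▸ map_rel g h)
    · exact absurd (Setoid.refl' _ _) (hx' y)

theorem missed_comp {X Y Z : Type} [Finite X] (S : Setoid X) (j : Y → X) (o : Z → Y) :
    missed S (j ∘ o) = missed S j + missed (S.comap j) o := by
  have key : missed (S.comap j) o = Nat.card {q : Quotient S //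
      (∀ z, q ≠ Quotient.mk S (j (o z))) ∧ ∃ y, q = Quotient.mk S (j y)} := by
    let F : Quotient (S.comap j) → Quotient S := Quotient.map j fun _ _ h => h
    have hF : ∀ q : Quotient (S.comap j), (∀ z, q ≠ Quotient.mk _ (o z)) →
        (∀ z, F q ≠ Quotient.mk S (j (o z))) ∧ ∃ y, F q = Quotient.mk S (j y) := by
      intro q
      refine Quotient.inductionOn q ?_
      exact fun y hy => ⟨fun z h => hy z (Quotient.sound (Quotient.exact h : S _ _)), y, rfl⟩
    refine Nat.card_congr (Equiv.ofBijective (fun q => ⟨F q.1, hF q.1 q.2⟩) ⟨?_, ?_⟩)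
    · rintro ⟨q, hq⟩ ⟨q', hq'⟩ h
      have h' : F q = F q' := congrArg Subtype.val h
      refine Subtype.ext ?_
      change q = q'
      clear h hq hq'
      revert h'
      refine Quotient.inductionOn₂ q q' ?_
      exact fun y y' h' => Quotient.sound (Quotient.exact h' : S _ _)
    · rintro ⟨_, hq, y, rfl⟩
      exact ⟨⟨Quotient.mk _ y, fun z h => hq z (Quotient.sound (Quotient.exact h : S.comap j _ _))⟩, rfl⟩
  rw [key]
  let B : Quotient S → Prop := fun q => ∀ z, q ≠ Quotient.mk S (j (o z))
  let A : Quotient S → Prop := fun q => ∀ y, q ≠ Quotient.mk S (j y)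
  have hd : missed S (j ∘ o) =
      Nat.card {q // A q} + Nat.card {q : Quotient S // B q ∧ ¬ A q} := by
    rw [← Nat.card_sum]
    classical
    refine Nat.card_congr ⟨fun q => if h : A q.1 then Sum.inl ⟨q.1, h⟩ else Sum.inr ⟨q.1, q.2, h⟩,
      Sum.elim (fun q => ⟨q.1, fun z => q.2 (o z)⟩) (fun q => ⟨q.1, q.2.1⟩), ?_, ?_⟩
    · intro q
      by_cases h : A q.1 <;> simp [h]
    · rintro (q | q)
      · simp [q.2]
      · simp [q.2.2]
  rw [hd]
  congr 1
  refine Nat.card_congr (Equiv.subtypeEquivRight fun q => ?_)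
  simp [A, B]

/-! ### Partition diagrams -/

/-- The set `{1, …, k, 1', …, k'}`: `Sum.inl` is the top row, `Sum.inr` the bottom row. -/
abbrev Vertex (k : ℕ) : Type := Fin k ⊕ Fin k

/-- The label in `{1, …, k}` of an element of `Fin k`. -/
def label {k : ℕ} (a : Fin k) : ℕ := a.val + 1

/-- The label `i` of the vertex `i` and of the vertex `i'`. -/
def vlabel {k : ℕ} (v : Vertex k) : ℕ := Sum.elim label label v

/-- Set partitions of `{1, …, k, 1', …, k'}`, given by the relation of lying in the same block. -/
abbrev Diagram (k : ℕ) : Type := Setoid (Vertex k)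

/-- Rows `0`, `1` of the three-row picture: the two rows of the upper diagram. -/
def upper {k : ℕ} (v : Vertex k) : Fin 3 × Fin k := Sum.elim (fun a => (0, a)) (fun a => (1, a)) v

/-- Rows `1`, `2` of the three-row picture: the two rows of the lower diagram. -/
def lower {k : ℕ} (v : Vertex k) : Fin 3 × Fin k := Sum.elim (fun a => (1, a)) (fun a => (2, a)) v

/-- Rows `0`, `2` of the three-row picture: the two rows of the composite diagram. -/
def outer {k : ℕ} (v : Vertex k) : Fin 3 × Fin k := Sum.elim (fun a => (0, a)) (fun a => (2, a)) v

/-- `ρ` placed above `τ`, the bottom row of `ρ` being identified with the top row of `τ`: the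
equivalence relation on the three rows generated by `ρ` and `τ`. -/
def stack {k : ℕ} (ρ τ : Diagram k) : Setoid (Fin 3 × Fin k) := ρ.map upper ⊔ τ.map lower

/-- The composition `ρ ∘ τ`. -/
@[reducible] def Diagram.comp {k : ℕ} (ρ τ : Diagram k) : Diagram k := (stack ρ τ).comap outer

/-- The number of blocks that lie entirely in the middle row. -/
def removed {k : ℕ} (ρ τ : Diagram k) : ℕ := missed (stack ρ τ) outer

/-- The identity diagram, with blocks `{i, i'}`. -/
@[reducible] def Diagram.id (k : ℕ) : Diagram k := Setoid.ker vlabel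

theorem label_injective {k : ℕ} : Function.Injective (label (k := k)) := by
  intro a b h
  exact Fin.ext (Nat.succ.inj h)

/-- Rows `0`, `1`, `2` of the four-row picture. -/
def rows012 {k : ℕ} (x : Fin 3 × Fin k) : Fin 4 × Fin k := (Fin.castSucc x.1, x.2)
/-- Rows `1`, `2`, `3` of the four-row picture. -/
def rows123 {k : ℕ} (x : Fin 3 × Fin k) : Fin 4 × Fin k := (Fin.succ x.1, x.2)
/-- Rows `0`, `2`, `3` of the four-row picture. -/
def rows023 {k : ℕ} (x : Fin 3 × Fin k) : Fin 4 × Fin k := (Fin.succAbove 1 x.1, x.2)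
/-- Rows `0`, `1`, `3` of the four-row picture. -/
def rows013 {k : ℕ} (x : Fin 3 × Fin k) : Fin 4 × Fin k := (Fin.succAbove 2 x.1, x.2)

/-- Three diagrams on top of each other. -/
def stack4 {k : ℕ} (ρ τ υ : Diagram k) : Setoid (Fin 4 × Fin k) :=
  ρ.map (rows012 ∘ upper) ⊔ τ.map (rows012 ∘ lower) ⊔ υ.map (rows123 ∘ lower)

theorem comap_map_of {X X' Y Z : Type} (S : Setoid X) {g : X → X'} (hg : Function.Injective g)
    (j : Y → X') {u : Z → Y} (o : Z → X) (h : ∀ z, j (u z) = g (o z))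
    (hj : Function.Injective j)
    (hr : ∀ y x, j y = g x → ∃ z, u z = y) :
    (S.map g).comap j = (S.comap o).map u := by
  refine le_antisymm ?_ (map_le_iff.2 fun z z' hz => ?_)
  · intro y y' hy
    rcases (map_rel_iff hg).1 hy with hy | ⟨a, b, hab, ha, hb⟩
    · rw [hj hy]
    · obtain ⟨z, rfl⟩ := hr y a ha.symm
      obtain ⟨z', rfl⟩ := hr y' b hb.symm
      refine map_rel u (?_ : S _ _)
      rw [h] at ha hb
      rwa [hg ha, hg hb] at hab
  · change S.map g (j (u z)) (j (u z'))
    rw [h, h]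
    exact map_rel g hz

theorem rows012_injective {k : ℕ} : Function.Injective (rows012 (k := k)) := by
  rintro ⟨a, b⟩ ⟨c, d⟩ h
  simpa [rows012] using h

theorem rows123_injective {k : ℕ} : Function.Injective (rows123 (k := k)) := by
  rintro ⟨a, b⟩ ⟨c, d⟩ h
  simpa [rows123] using h

theorem rows023_injective {k : ℕ} : Function.Injective (rows023 (k := k)) := by
  rintro ⟨a, b⟩ ⟨c, d⟩ h
  simpa [rows023, Fin.succAbove_right_inj] using h

theorem rows013_injective {k : ℕ} : Function.Injective (rows013 (k := k)) := by
  rintro ⟨a, b⟩ ⟨c, d⟩ h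
  simpa [rows013, Fin.succAbove_right_inj] using h

theorem upper_injective {k : ℕ} : Function.Injective (upper (k := k)) := by
  rintro (a | a) (b | b) h <;> simp_all [upper]

theorem lower_injective {k : ℕ} : Function.Injective (lower (k := k)) := by
  rintro (a | a) (b | b) h <;> simp_all [lower]

theorem stack4_left {k : ℕ} (ρ τ υ : Diagram k) :
    stack4 ρ τ υ = (stack ρ τ).map rows012 ⊔ (υ.map lower).map rows023 := by
  rw [stack4, stack, map_sup, map_map, map_map, map_map]
  congr 2
  funext v
  rcases v with a | a <;> rfl

theorem stack4_right {k : ℕ} (ρ τ υ : Diagram k) :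
    stack4 ρ τ υ = (stack τ υ).map rows123 ⊔ (ρ.map upper).map rows013 := by
  have e1 : (rows012 ∘ lower : Vertex k → _) = rows123 ∘ upper := by
    funext v; rcases v with a | a <;> rfl
  have e2 : (rows012 ∘ upper : Vertex k → _) = rows013 ∘ upper := by
    funext v; rcases v with a | a <;> rfl
  rw [stack4, stack, map_sup, map_map, map_map, map_map, e1, e2, sup_assoc, sup_comm]

theorem stack_comp_left {k : ℕ} (ρ τ υ : Diagram k) :
    (stack4 ρ τ υ).comap rows023 = stack (ρ.comp τ) υ := by
  rw [stack4_left, comap_glue, stack, Diagram.comp]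
  congr 1
  refine comap_map_of _ rows012_injective _ _ ?_ rows023_injective ?_
  · rintro (a | a) <;> rfl
  · rintro ⟨r, a⟩ ⟨r', a'⟩ h
    fin_cases r
    · exact ⟨Sum.inl a, rfl⟩
    · exact ⟨Sum.inr a, rfl⟩
    · exfalso
      have h1 : (Fin.succAbove 1 (2 : Fin 3) : Fin 4) = Fin.castSucc r' := congrArg Prod.fst h
      clear h
      revert h1
      revert r'
      decide

theorem stack_comp_right {k : ℕ} (ρ τ υ : Diagram k) :
    (stack4 ρ τ υ).comap rows013 = stack ρ (τ.comp υ) := by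
  rw [stack4_right, comap_glue, stack, Diagram.comp, sup_comm]
  congr 1
  refine comap_map_of _ rows123_injective _ _ ?_ rows013_injective ?_
  · rintro (a | a) <;> rfl
  · rintro ⟨r, a⟩ ⟨r', a'⟩ h
    fin_cases r
    · exfalso
      have h1 : (Fin.succAbove 2 (0 : Fin 3) : Fin 4) = Fin.succ r' := congrArg Prod.fst h
      clear h
      revert h1
      revert r'
      decide
    · exact ⟨Sum.inl a, rfl⟩
    · exact ⟨Sum.inr a, rfl⟩

theorem rows_outer {k : ℕ} : (rows023 ∘ outer : Vertex k → _) = rows013 ∘ outer := by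
  funext v; rcases v with a | a <;> rfl

theorem comp_assoc {k : ℕ} (ρ τ υ : Diagram k) :
    (ρ.comp τ).comp υ = ρ.comp (τ.comp υ) := by
  change (stack _ _).comap outer = (stack _ _).comap outer
  rw [← stack_comp_left, ← stack_comp_right]
  change (stack4 ρ τ υ).comap (rows023 ∘ outer) = (stack4 ρ τ υ).comap (rows013 ∘ outer)
  rw [rows_outer]

theorem missed_stack4_left {k : ℕ} (ρ τ υ : Diagram k) :
    missed (stack4 ρ τ υ) rows023 = removed ρ τ := by
  rw [stack4_left, missed_glue, removed]
  refine missed_map _ rows012_injective _ _ ?_ ?_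
  · rintro ⟨r, a⟩
    fin_cases r
    · exact Or.inl ⟨(0, a), rfl⟩
    · exact Or.inl ⟨(1, a), rfl⟩
    · exact Or.inl ⟨(2, a), rfl⟩
    · exact Or.inr ⟨(2, a), rfl⟩
  · rintro ⟨r, a⟩
    fin_cases r
    · exact ⟨fun _ => ⟨Sum.inl a, rfl⟩, fun _ => ⟨(0, a), rfl⟩⟩
    · constructor
      · rintro ⟨⟨r', a'⟩, h⟩
        have h1 : Fin.succAbove 1 r' = (1 : Fin 4) := congrArg Prod.fst h
        exact absurd h1 (Fin.succAbove_ne _ _)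
      · rintro ⟨v | v, h⟩ <;> simp [outer] at h
    · exact ⟨fun _ => ⟨Sum.inr a, rfl⟩, fun _ => ⟨(1, a), rfl⟩⟩

theorem missed_stack4_right {k : ℕ} (ρ τ υ : Diagram k) :
    missed (stack4 ρ τ υ) rows013 = removed τ υ := by
  rw [stack4_right, missed_glue, removed]
  refine missed_map _ rows123_injective _ _ ?_ ?_
  · rintro ⟨r, a⟩
    fin_cases r
    · exact Or.inr ⟨(0, a), rfl⟩
    · exact Or.inl ⟨(0, a), rfl⟩
    · exact Or.inl ⟨(1, a), rfl⟩
    · exact Or.inl ⟨(2, a), rfl⟩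
  · rintro ⟨r, a⟩
    fin_cases r
    · exact ⟨fun _ => ⟨Sum.inl a, rfl⟩, fun _ => ⟨(1, a), rfl⟩⟩
    · constructor
      · rintro ⟨⟨r', a'⟩, h⟩
        have h1 : Fin.succAbove 2 r' = (2 : Fin 4) := congrArg Prod.fst h
        exact absurd h1 (Fin.succAbove_ne _ _)
      · rintro ⟨v | v, h⟩ <;> simp [outer] at h
    · exact ⟨fun _ => ⟨Sum.inr a, rfl⟩, fun _ => ⟨(2, a), rfl⟩⟩

theorem removed_assoc {k : ℕ} (ρ τ υ : Diagram k) :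
    removed ρ τ + removed (ρ.comp τ) υ = removed τ υ + removed ρ (τ.comp υ) := by
  rw [← missed_stack4_left ρ τ υ, ← missed_stack4_right ρ τ υ, removed, removed,
    ← stack_comp_left, ← stack_comp_right, ← missed_comp, ← missed_comp, rows_outer]

theorem missed_eq_zero {X Y : Type} {S : Setoid X} {j : Y → X} (h : ∀ x, ∃ y, S x (j y)) :
    missed S j = 0 := by
  have : IsEmpty {q : Quotient S // ∀ y : Y, q ≠ Quotient.mk S (j y)} := by
    refine ⟨?_⟩
    rintro ⟨q, hq⟩
    revert hq
    refine Quotient.inductionOn q ?_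
    intro x hx
    obtain ⟨y, hy⟩ := h x
    exact ne_mk_iff.1 hx y hy
  exact Nat.card_of_isEmpty

theorem stack_upper {k : ℕ} {ρ τ : Diagram k} {v w : Vertex k} (h : ρ v w) :
    stack ρ τ (upper v) (upper w) :=
  (le_sup_left : ρ.map upper ≤ stack ρ τ) (map_rel upper h)

theorem stack_lower {k : ℕ} {ρ τ : Diagram k} {v w : Vertex k} (h : τ v w) :
    stack ρ τ (lower v) (lower w) :=
  (le_sup_right : τ.map lower ≤ stack ρ τ) (map_rel lower h)

theorem id_rel {k : ℕ} (a : Fin k) : Diagram.id k (Sum.inl a) (Sum.inr a) := rfl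

theorem id_comp {k : ℕ} (ρ : Diagram k) : (Diagram.id k).comp ρ = ρ := by
  refine le_antisymm ?_ ?_
  · let g : Fin 3 × Fin k → Vertex k := fun x => if x.1 = 2 then Sum.inr x.2 else Sum.inl x.2
    have hg : stack (Diagram.id k) ρ ≤ ρ.comap g := by
      refine sup_le (map_le_iff.2 ?_) (map_le_iff.2 ?_)
      · rintro (a | a) (b | b) h <;>
        · have : a = b := label_injective h
          subst this
          exact ρ.refl _
      · rintro (a | a) (b | b) h <;> exact h
    rintro (a | a) (b | b) h <;> exact hg h
  · have key : ∀ v : Vertex k, stack (Diagram.id k) ρ (outer v) (lower v) := by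
      rintro (a | a)
      · exact stack_upper (id_rel a)
      · exact Setoid.refl' _ _
    intro v w h
    change stack (Diagram.id k) ρ (outer v) (outer w)
    exact Setoid.trans' _ (key v) (Setoid.trans' _ (stack_lower h)
      (Setoid.symm' (stack (Diagram.id k) ρ) (key w)))

theorem comp_id {k : ℕ} (ρ : Diagram k) : ρ.comp (Diagram.id k) = ρ := by
  refine le_antisymm ?_ ?_
  · let g : Fin 3 × Fin k → Vertex k := fun x => if x.1 = 0 then Sum.inl x.2 else Sum.inr x.2
    have hg : stack ρ (Diagram.id k) ≤ ρ.comap g := by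
      refine sup_le (map_le_iff.2 ?_) (map_le_iff.2 ?_)
      · rintro (a | a) (b | b) h <;> exact h
      · rintro (a | a) (b | b) h <;>
        · have : a = b := label_injective h
          subst this
          exact ρ.refl _
    rintro (a | a) (b | b) h <;> exact hg h
  · have key : ∀ v : Vertex k, stack ρ (Diagram.id k) (outer v) (upper v) := by
      rintro (a | a)
      · exact Setoid.refl' _ _
      · exact Setoid.symm' _ (stack_lower (id_rel a))
    intro v w h
    change stack ρ (Diagram.id k) (outer v) (outer w)
    exact Setoid.trans' _ (key v) (Setoid.trans' _ (stack_upper h)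
      (Setoid.symm' (stack ρ (Diagram.id k)) (key w)))

theorem removed_id_left {k : ℕ} (ρ : Diagram k) : removed (Diagram.id k) ρ = 0 := by
  refine missed_eq_zero ?_
  rintro ⟨r, a⟩
  fin_cases r
  · exact ⟨Sum.inl a, Setoid.refl' _ _⟩
  · exact ⟨Sum.inl a, Setoid.symm' _ (stack_upper (id_rel a))⟩
  · exact ⟨Sum.inr a, Setoid.refl' _ _⟩

theorem removed_id_right {k : ℕ} (ρ : Diagram k) : removed ρ (Diagram.id k) = 0 := by
  refine missed_eq_zero ?_
  rintro ⟨r, a⟩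
  fin_cases r
  · exact ⟨Sum.inl a, Setoid.refl' _ _⟩
  · exact ⟨Sum.inr a, stack_lower (id_rel a)⟩
  · exact ⟨Sum.inr a, Setoid.refl' _ _⟩

/-! ### The partition algebra -/

/-- The partition algebra `𝒜_k(z)`: the free `ℤ[z]`-module on the set partitions of
`{1, …, k, 1', …, k'}`. -/
def PartitionAlgebra (k : ℕ) : Type := Diagram k →₀ ℤ[X]

namespace PartitionAlgebra

instance (k : ℕ) : AddCommGroup (PartitionAlgebra k) :=
  inferInstanceAs (AddCommGroup (Diagram k →₀ ℤ[X]))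

instance (k : ℕ) : Module ℤ[X] (PartitionAlgebra k) :=
  inferInstanceAs (Module ℤ[X] (Diagram k →₀ ℤ[X]))

/-- The diagram basis. -/
def basis (k : ℕ) : Module.Basis (Diagram k) ℤ[X] (PartitionAlgebra k) :=
  Module.Basis.ofRepr (LinearEquiv.refl ℤ[X] (Diagram k →₀ ℤ[X]))

/-- The bilinear product with `ρ τ = z ^ ℓ (ρ ∘ τ)`, where `ℓ` is the number of blocks removed
from the middle row. -/
def mulHom (k : ℕ) :
    PartitionAlgebra k →ₗ[ℤ[X]] PartitionAlgebra k →ₗ[ℤ[X]] PartitionAlgebra k :=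
  (basis k).constr ℤ[X] fun ρ => (basis k).constr ℤ[X] fun τ =>
    (X : ℤ[X]) ^ removed ρ τ • basis k (ρ.comp τ)

theorem mulHom_basis {k : ℕ} (ρ τ : Diagram k) :
    mulHom k (basis k ρ) (basis k τ) = (X : ℤ[X]) ^ removed ρ τ • basis k (ρ.comp τ) := by
  rw [mulHom, Module.Basis.constr_basis, Module.Basis.constr_basis]

theorem mulHom_assoc {k : ℕ} (a b c : PartitionAlgebra k) :
    mulHom k (mulHom k a b) c = mulHom k a (mulHom k b c) := by
  have h1 (ρ τ υ : Diagram k) :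
      mulHom k (mulHom k (basis k ρ) (basis k τ)) (basis k υ) =
        mulHom k (basis k ρ) (mulHom k (basis k τ) (basis k υ)) := by
    simp only [mulHom_basis, map_smul, LinearMap.smul_apply, smul_smul, ← pow_add]
    rw [removed_assoc, comp_assoc]
  have h2 (ρ τ : Diagram k) (c : PartitionAlgebra k) :
      mulHom k (mulHom k (basis k ρ) (basis k τ)) c =
        mulHom k (basis k ρ) (mulHom k (basis k τ) c) :=
    LinearMap.congr_fun ((basis k).ext (f₁ := mulHom k (mulHom k (basis k ρ) (basis k τ)))
      (f₂ := mulHom k (basis k ρ) ∘ₗ mulHom k (basis k τ)) (h1 ρ τ)) c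
  have h3 (ρ : Diagram k) (b c : PartitionAlgebra k) :
      mulHom k (mulHom k (basis k ρ) b) c = mulHom k (basis k ρ) (mulHom k b c) :=
    LinearMap.congr_fun ((basis k).ext
      (f₁ := (mulHom k).flip c ∘ₗ mulHom k (basis k ρ))
      (f₂ := mulHom k (basis k ρ) ∘ₗ (mulHom k).flip c) (fun τ => h2 ρ τ c)) b
  exact LinearMap.congr_fun ((basis k).ext
      (f₁ := (mulHom k).flip c ∘ₗ (mulHom k).flip b)
      (f₂ := (mulHom k).flip (mulHom k b c)) (fun ρ => h3 ρ b c)) a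

theorem mulHom_one_left {k : ℕ} (a : PartitionAlgebra k) :
    mulHom k (basis k (Diagram.id k)) a = a := by
  refine LinearMap.congr_fun ((basis k).ext (f₁ := mulHom k (basis k (Diagram.id k)))
    (f₂ := LinearMap.id) fun ρ => ?_) a
  rw [mulHom_basis, removed_id_left, id_comp, pow_zero, one_smul, LinearMap.id_apply]

theorem mulHom_one_right {k : ℕ} (a : PartitionAlgebra k) :
    mulHom k a (basis k (Diagram.id k)) = a := by
  refine LinearMap.congr_fun ((basis k).ext (f₁ := (mulHom k).flip (basis k (Diagram.id k)))
    (f₂ := LinearMap.id) fun ρ => ?_) a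
  rw [LinearMap.flip_apply, mulHom_basis, removed_id_right, comp_id, pow_zero, one_smul,
    LinearMap.id_apply]

instance (k : ℕ) : Ring (PartitionAlgebra k) where
  __ := (inferInstance : AddCommGroup (PartitionAlgebra k))
  mul a b := mulHom k a b
  one := basis k (Diagram.id k)
  mul_assoc := mulHom_assoc
  one_mul := mulHom_one_left
  mul_one := mulHom_one_right
  left_distrib a b c := map_add (mulHom k a) b c
  right_distrib a b c := LinearMap.map_add₂ (mulHom k) a b c
  zero_mul a := LinearMap.map_zero₂ (mulHom k) a
  mul_zero a := map_zero (mulHom k a)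

instance (k : ℕ) : Algebra ℤ[X] (PartitionAlgebra k) :=
  Algebra.ofModule (fun r a b => LinearMap.map_smul₂ (mulHom k) r a b)
    (fun r a b => map_smul (mulHom k a) r b)

/-- The product of two basis diagrams. -/
theorem basis_mul_basis {k : ℕ} (ρ τ : Diagram k) :
    basis k ρ * basis k τ = (X : ℤ[X]) ^ removed ρ τ • basis k (ρ.comp τ) :=
  mulHom_basis ρ τ

theorem one_eq_basis (k : ℕ) : (1 : PartitionAlgebra k) = basis k (Diagram.id k) := rfl

/-! ### Generators -/

/-- The transposition `s_i`, for `1 ≤ i ≤ k - 1`: top vertex `a` and bottom vertex `b'` lie in the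
same block iff the transposition of `i` and `i + 1` maps `a` to `b`. -/
def s (k i : ℕ) : PartitionAlgebra k :=
  basis k (Setoid.ker fun v : Vertex k =>
    Sum.elim (fun a => Equiv.swap i (i + 1) (label a)) (fun b => label b) v)

/-- The generator `p_j`, for `1 ≤ j ≤ k`: the vertices `j` and `j'` are singleton blocks, the
other blocks are `{a, a'}`. -/
def p (k j : ℕ) : PartitionAlgebra k :=
  basis k (Setoid.ker fun v : Vertex k =>
    if vlabel v = j then (Sum.inl v : Vertex k ⊕ ℕ) else Sum.inr (vlabel v))

/-- The generator `p_{i + 1/2}`, for `1 ≤ i ≤ k - 1`: one block is `{i, i + 1, i', (i + 1)'}`, the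
other blocks are `{a, a'}`. -/
def pHalf (k i : ℕ) : PartitionAlgebra k :=
  basis k (Setoid.ker fun v : Vertex k => if vlabel v = i + 1 then i else vlabel v)

/-! ### Jucys-Murphy elements -/

/-- The recursion formula that gives `L_{i+1}` in terms of `x = L_i` and `y = σ_{i+1}`. -/
def stepL (k i : ℕ) (x y : PartitionAlgebra k) : PartitionAlgebra k :=
  - (s k i * x * pHalf k i)
    - pHalf k i * x * s k i
    + pHalf k i * x * p k (i + 1) * pHalf k i
    + s k i * x * s k i
    + y

/-- The recursion formula that gives `σ_{i+1}` in terms of `x = L_{i-1}` and `y = σ_i`. -/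
def stepσ (k i : ℕ) (x y : PartitionAlgebra k) : PartitionAlgebra k :=
  s k (i - 1) * s k i * y * s k i * s k (i - 1)
    + s k i * pHalf k (i - 1) * x * s k i * pHalf k (i - 1) * s k i
    + pHalf k (i - 1) * x * s k i * pHalf k (i - 1)
    - s k i * pHalf k (i - 1) * x * s k (i - 1) * pHalf k i * p k i * pHalf k (i - 1)
    - pHalf k (i - 1) * p k i * pHalf k i * s k (i - 1) * x * pHalf k (i - 1) * s k i

/-- The pair `(L_i, σ_i)`, regarded in `𝒜_k(z)` for `i ≤ k`. There is no `σ_0`; the second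
component at `0` is never used. -/
def pairLσ (k : ℕ) : ℕ → PartitionAlgebra k × PartitionAlgebra k
  | 0 => (0, 0)
  | 1 => (p k 1, 1)
  | 2 => (stepL k 1 (p k 1) (s k 1), s k 1)
  | n + 3 =>
    let y := stepσ k (n + 2) (pairLσ k (n + 1)).1 (pairLσ k (n + 2)).2
    (stepL k (n + 2) (pairLσ k (n + 2)).1 y, y)

/-- The element `L_i`, regarded in `𝒜_k(z)` for `i ≤ k`. -/
def L (k i : ℕ) : PartitionAlgebra k := (pairLσ k i).1

/-- The element `σ_i` (`1 ≤ i`), regarded in `𝒜_k(z)` for `i ≤ k`. -/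
def σ (k i : ℕ) : PartitionAlgebra k := (pairLσ k i).2

theorem L_zero (k : ℕ) : L k 0 = 0 := rfl

theorem L_one (k : ℕ) : L k 1 = p k 1 := rfl

theorem σ_one (k : ℕ) : σ k 1 = 1 := rfl

theorem σ_two (k : ℕ) : σ k 2 = s k 1 := rfl

theorem L_succ (k i : ℕ) (hi : 1 ≤ i) :
    L k (i + 1) =
      - (s k i * L k i * pHalf k i) - pHalf k i * L k i * s k i
        + pHalf k i * L k i * p k (i + 1) * pHalf k i + s k i * L k i * s k i + σ k (i + 1) := by
  match i, hi with
  | 1, _ => rfl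
  | n + 2, _ => rfl

theorem σ_succ (k i : ℕ) (hi : 2 ≤ i) :
    σ k (i + 1) =
      s k (i - 1) * s k i * σ k i * s k i * s k (i - 1)
        + s k i * pHalf k (i - 1) * L k (i - 1) * s k i * pHalf k (i - 1) * s k i
        + pHalf k (i - 1) * L k (i - 1) * s k i * pHalf k (i - 1)
        - s k i * pHalf k (i - 1) * L k (i - 1) * s k (i - 1) * pHalf k i * p k i * pHalf k (i - 1)
        - pHalf k (i - 1) * p k i * pHalf k i * s k (i - 1) * L k (i - 1) * pHalf k (i - 1)
            * s k i := by
  match i, hi with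
  | n + 2, _ => rfl

/-- The element `σ_{i + 1/2}`, regarded in `𝒜_k(z)` for `i + 1 ≤ k`. In the recursive clause
`n + 2` plays the role of `i`. -/
def σHalf (k : ℕ) : ℕ → PartitionAlgebra k
  | 0 => 1
  | 1 => 1
  | n + 2 =>
    s k (n + 1) * s k (n + 2) * σHalf k (n + 1) * s k (n + 2) * s k (n + 1)
      + pHalf k (n + 1) * L k (n + 1) * s k (n + 2) * pHalf k (n + 1) * s k (n + 2)
      + s k (n + 2) * pHalf k (n + 1) * L k (n + 1) * s k (n + 2) * pHalf k (n + 1)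
      - pHalf k (n + 1) * L k (n + 1) * s k (n + 1) * pHalf k (n + 2) * p k (n + 2)
          * pHalf k (n + 1)
      - s k (n + 2) * pHalf k (n + 1) * p k (n + 2) * pHalf k (n + 2) * s k (n + 1) * L k (n + 1)
          * pHalf k (n + 1) * s k (n + 2)

/-- The element `L_{i + 1/2}`, regarded in `𝒜_k(z)` for `i + 1 ≤ k`. In the recursive clause
`n + 1` plays the role of `i`. -/
def LHalf (k : ℕ) : ℕ → PartitionAlgebra k
  | 0 => 0
  | n + 1 =>
    - (L k (n + 1) * pHalf k (n + 1))
      - pHalf k (n + 1) * L k (n + 1)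
      + pHalf k (n + 1) * L k (n + 1) * p k (n + 1) * pHalf k (n + 1)
      + s k (n + 1) * LHalf k n * s k (n + 1)
      + σHalf k (n + 1)

end PartitionAlgebra

end

end PartitionAlg

namespace PartitionAlg

noncomputable section

open Polynomial

/-! ### Counting colorings -/

/-! Specialize `z` to a natural number `n` and let diagrams act on integer functions of colorings
with `n` colors: the matrix entry between a top-row and a bottom-row coloring is 1 if together they
are constant on every block, and 0 otherwise. In a composition the middle row is summed over. Each
block lying entirely in that row can be colored freely, which produces exactly the factor `n ^ ℓ`,
so the action is multiplicative (`Diagram.act_mul_act`, `actAddHom_mul`). Taken over all `n` these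
actions are faithful (`eq_zero_of_actAddHom`), so every identity in the algebra may be checked on
colorings.

On colorings `f` the intricate recursions have simple solutions (`act_σHalf_and_L_and_σ`,
`act_LHalf`). `L_i` sums over all colors `a` the exchange of `a` with `f i` at the labels `1, …, i`.
`σ_{i+1}` exchanges `f i` and `f (i + 1)` at `1, …, i + 1`, and `σ_{i+1/2}` exchanges the same two
colors at `1, …, i - 1` only. `L_{i+1/2}` is `n` minus the sum over `a` of the exchanges of `a` with
`f (i + 1)` at `1, …, i`.

The commutation relations then have the same origin as Schur–Weyl duality: a permutation of the
colors, applied uniformly at the labels `1, …, m`, commutes with the generators acting on those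
labels, as long as the label that supplies the exchanged color keeps its color. Coloring all of `ℕ`
lets labels be plain natural numbers; only `1, …, k` are ever changed. -/

open Classical in
/-- The number of extensions of a coloring `c₀` along `j` to a coloring that is constant on the
classes of `S`. -/
theorem card_extensions {X Y C : Type} [Finite X] (S : Setoid X) (j : Y → X) (c₀ : Y → C) :
    Nat.card {c : X → C // S ≤ Setoid.ker c ∧ c ∘ j = c₀} =
      if S.comap j ≤ Setoid.ker c₀ then Nat.card C ^ missed S j else 0 := by
  split_ifs with h
  · rw [missed, ← Nat.card_fun]
    have hS : ∀ {x x'}, S x x' → ((∃ y, S x (j y)) ↔ ∃ y, S x' (j y)) := fun hx =>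
      ⟨fun ⟨y, hy⟩ => ⟨y, S.trans (S.symm hx) hy⟩, fun ⟨y, hy⟩ => ⟨y, S.trans hx hy⟩⟩
    have hq : ∀ {x}, (¬ ∃ y, S x (j y)) → ∀ y, Quotient.mk S x ≠ Quotient.mk S (j y) :=
      fun hx => ne_mk_iff.2 (not_exists.1 hx)
    -- On a class that meets the image of `j` the color is forced by `c₀`; on a missed class it is
    -- free. Hence an extension is the same as a function on the missed classes.
    refine Nat.card_congr
      { toFun := fun c q => Quotient.lift c.1 (fun _ _ hab => c.2.1 hab) q.1
        invFun := fun m => ⟨fun x => if hx : ∃ y, S x (j y) then c₀ hx.choose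
          else m ⟨Quotient.mk S x, hq hx⟩, ?_, ?_⟩
        left_inv := ?_
        right_inv := ?_ }
    · intro x x' hxx
      rw [Setoid.ker_def]
      by_cases hx : ∃ y, S x (j y)
      · have hx' := (hS hxx).1 hx
        simp only [dif_pos hx, dif_pos hx']
        exact h (S.trans (S.symm hx.choose_spec) (S.trans hxx hx'.choose_spec))
      · have hx' := fun h' => hx ((hS hxx).2 h')
        simp only [dif_neg hx, dif_neg hx']
        congr 2
        exact Quotient.sound hxx
    · funext y
      have hy : ∃ y', S (j y) (j y') := ⟨y, S.refl _⟩
      simp only [Function.comp, dif_pos hy]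
      exact (h hy.choose_spec).symm
    · rintro ⟨c, hc, rfl⟩
      refine Subtype.ext (funext fun x => ?_)
      by_cases hx : ∃ y, S x (j y)
      · simp only [dif_pos hx]
        exact (hc hx.choose_spec).symm
      · simp only [dif_neg hx, Quotient.lift_mk]
    · intro m
      funext ⟨q, hq'⟩
      revert hq'
      refine Quotient.inductionOn q fun x hx => ?_
      simp only [Quotient.lift_mk]
      rw [dif_neg]
      rintro ⟨y, hy⟩
      exact hx y (Quotient.sound hy)
  · rw [Nat.card_eq_zero]
    refine Or.inl ⟨?_⟩
    rintro ⟨c, hc, rfl⟩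
    exact h fun y y' hy => hc hy

/-- The coloring of the three-row picture with rows `f`, `g`, `h`. -/
def threeRows {k : ℕ} {C : Type} (f g h : Fin k → C) (x : Fin 3 × Fin k) : C := ![f, g, h] x.1 x.2

theorem stack_le_ker_iff {k : ℕ} {C : Type} (ρ τ : Diagram k) (f g h : Fin k → C) :
    stack ρ τ ≤ Setoid.ker (threeRows f g h) ↔
      ρ ≤ Setoid.ker (Sum.elim f g) ∧ τ ≤ Setoid.ker (Sum.elim g h) := by
  rw [stack, sup_le_iff, map_le_iff, map_le_iff]
  have h1 : threeRows f g h ∘ upper = Sum.elim f g := by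
    funext v; rcases v with a | a <;> rfl
  have h2 : threeRows f g h ∘ lower = Sum.elim g h := by
    funext v; rcases v with a | a <;> rfl
  rw [← h1, ← h2]
  rfl

-- The admissible middle rows `g` are the extensions of the outer coloring to a coloring of the
-- three rows that is constant on the classes of `stack ρ τ`, so `card_extensions` counts them.
open Classical in
theorem sum_middle_row {k n : ℕ} (ρ τ : Diagram k) (f h : Fin k → Fin n) :
    (∑ g : Fin k → Fin n, if ρ ≤ Setoid.ker (Sum.elim f g) ∧ τ ≤ Setoid.ker (Sum.elim g h)
      then (1 : ℤ) else 0) =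
      if ρ.comp τ ≤ Setoid.ker (Sum.elim f h) then (n : ℤ) ^ removed ρ τ else 0 := by
  have key := card_extensions (stack ρ τ) outer (Sum.elim f h)
  rw [Nat.card_fin] at key
  rw [Finset.sum_boole]
  rw [show (if ρ.comp τ ≤ Setoid.ker (Sum.elim f h) then (n : ℤ) ^ removed ρ τ else 0) =
    ((if ρ.comp τ ≤ Setoid.ker (Sum.elim f h) then n ^ removed ρ τ else 0 : ℕ) : ℤ) by
      split_ifs <;> simp]
  rw [Diagram.comp, removed, ← key, ← Fintype.card_subtype, ← Nat.card_eq_fintype_card]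
  congr 1
  refine Nat.card_congr
    { toFun := fun g => ⟨threeRows f g.1 h, (stack_le_ker_iff ..).2 g.2, ?_⟩
      invFun := fun c => ⟨fun a => c.1 (1, a), ?_⟩
      left_inv := fun g => rfl
      right_inv := fun c => ?_ }
  · funext v; rcases v with a | a <;> rfl
  all_goals
    have hc : threeRows f (fun a => c.1 (1, a)) h = c.1 := by
      funext ⟨r, a⟩
      fin_cases r
      · exact (congrFun c.2.2 (Sum.inl a)).symm
      · rfl
      · exact (congrFun c.2.2 (Sum.inr a)).symm
  · rw [← stack_le_ker_iff, hc]
    exact c.2.1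
  · exact Subtype.ext hc

/-! ### The action on functions of colorings -/

/-- The coloring of `ℕ` that agrees with `g` on the labels `1, …, k` and with `f` elsewhere. -/
def recolor {k : ℕ} {C : Type} (f : ℕ → C) (g : Fin k → C) (j : ℕ) : C :=
  if h : ∃ a : Fin k, label a = j then g h.choose else f j

theorem recolor_label {k : ℕ} {C : Type} (f : ℕ → C) (g : Fin k → C) (a : Fin k) :
    recolor f g (label a) = g a := by
  have h : ∃ b : Fin k, label b = label a := ⟨a, rfl⟩
  rw [recolor, dif_pos h, label_injective h.choose_spec]

theorem recolor_comp_label {k : ℕ} {C : Type} (f : ℕ → C) (g : Fin k → C) :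
    recolor f g ∘ label = g := funext (recolor_label f g)

theorem recolor_of_forall_ne {k : ℕ} {C : Type} (f : ℕ → C) (g : Fin k → C) {j : ℕ}
    (h : ∀ a : Fin k, label a ≠ j) : recolor f g j = f j := by
  rw [recolor, dif_neg (by simpa using h)]

theorem recolor_recolor {k : ℕ} {C : Type} (f : ℕ → C) (g h : Fin k → C) :
    recolor (recolor f g) h = recolor f h := by
  funext j
  by_cases hj : ∃ a : Fin k, label a = j
  · obtain ⟨a, rfl⟩ := hj
    rw [recolor_label, recolor_label]
  · rw [recolor_of_forall_ne _ _ (not_exists.1 hj), recolor_of_forall_ne _ _ (not_exists.1 hj),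
      recolor_of_forall_ne _ _ (not_exists.1 hj)]

theorem recolor_eq {k : ℕ} {C : Type} {f f' : ℕ → C} {g : Fin k → C}
    (h1 : ∀ a, g a = f' (label a)) (h2 : ∀ j, (∀ a : Fin k, label a ≠ j) → f j = f' j) :
    recolor f g = f' := by
  funext j
  by_cases hj : ∃ a : Fin k, label a = j
  · obtain ⟨a, rfl⟩ := hj
    rw [recolor_label, h1]
  · rw [recolor_of_forall_ne _ _ (not_exists.1 hj), h2 _ (not_exists.1 hj)]

open Classical in
/-- The action of a diagram on the functions of the colorings of `ℕ` with `n` colors. -/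
def Diagram.act {k : ℕ} (n : ℕ) (ρ : Diagram k) : Module.End ℤ ((ℕ → Fin n) → ℤ) where
  toFun F f := ∑ g : Fin k → Fin n,
    if ρ ≤ Setoid.ker (Sum.elim (f ∘ label) g) then F (recolor f g) else 0
  map_add' F G := by
    funext f
    simp only [Pi.add_apply, ← Finset.sum_add_distrib]
    exact Finset.sum_congr rfl fun g _ => by split_ifs <;> simp
  map_smul' c F := by
    funext f
    simp [Finset.mul_sum]

open Classical in
theorem Diagram.act_apply {k n : ℕ} (ρ : Diagram k) (F : (ℕ → Fin n) → ℤ) (f : ℕ → Fin n) :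
    ρ.act n F f = ∑ g : Fin k → Fin n,
      if ρ ≤ Setoid.ker (Sum.elim (f ∘ label) g) then F (recolor f g) else 0 := rfl

/-- This is matrix multiplication: once the sums are interchanged, the sum over the middle row is
`sum_middle_row`. -/
theorem Diagram.act_mul_act {k : ℕ} (n : ℕ) (ρ τ : Diagram k) :
    ρ.act n * τ.act n = (n : ℤ) ^ removed ρ τ • (ρ.comp τ).act n := by
  classical
  refine LinearMap.ext fun F => funext fun f => ?_
  rw [Module.End.mul_apply, LinearMap.smul_apply, Pi.smul_apply, smul_eq_mul]
  simp only [Diagram.act_apply, recolor_comp_label, recolor_recolor, Finset.mul_sum]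
  have h1 (g : Fin k → Fin n) :
      (if ρ ≤ Setoid.ker (Sum.elim (f ∘ label) g) then
        ∑ h, if τ ≤ Setoid.ker (Sum.elim g h) then F (recolor f h) else 0 else 0) =
      ∑ h, (if ρ ≤ Setoid.ker (Sum.elim (f ∘ label) g) ∧ τ ≤ Setoid.ker (Sum.elim g h)
        then (1 : ℤ) else 0) * F (recolor f h) := by
    split_ifs with hρ <;> simp [hρ]
  rw [Finset.sum_congr rfl fun g _ => h1 g, Finset.sum_comm]
  refine Finset.sum_congr rfl fun h _ => ?_
  rw [← Finset.sum_mul, sum_middle_row]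
  split_ifs <;> simp

-- Reads off a single matrix entry of `ρ`: the row and the column are the two halves of `c`. This is
-- what detects coefficients in the proof of faithfulness.
open Classical in
theorem Diagram.act_indicator {k n : ℕ} (ρ : Diagram k) (c : Vertex k → Fin n)
    (f : ℕ → Fin n) :
    ρ.act n (fun f => if f ∘ label = c ∘ Sum.inr then 1 else 0) (recolor f (c ∘ Sum.inl)) =
      if ρ ≤ Setoid.ker c then 1 else 0 := by
  rw [Diagram.act_apply, Finset.sum_eq_single (c ∘ Sum.inr)]
  · simp only [recolor_comp_label, if_true, Sum.elim_comp_inl_inr]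
  · intro g _ hg
    simp only [recolor_comp_label, if_neg hg, ite_self]
  · exact fun h => absurd (Finset.mem_univ _) h

namespace PartitionAlgebra

/-! ### The specialized representations and their joint faithfulness -/

theorem induction_linear {k : ℕ} {motive : PartitionAlgebra k → Prop} (x : PartitionAlgebra k)
    (zero : motive 0) (add : ∀ a b, motive a → motive b → motive (a + b))
    (smul_basis : ∀ (c : ℤ[X]) (ρ : Diagram k), motive (c • basis k ρ)) : motive x := by
  refine Finsupp.induction_linear (motive := motive) x zero add fun ρ c => ?_
  have h : (Finsupp.single ρ c : PartitionAlgebra k) = c • basis k ρ := by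
    refine (basis k).repr.injective ?_
    rw [map_smul, Module.Basis.repr_self, Finsupp.smul_single, smul_eq_mul, mul_one]
    rfl
  exact h ▸ smul_basis c ρ

/-- The action of the partition algebra, with `z` specialized to `n`, on the functions of the
colorings of `ℕ` with `n` colors. -/
def actAddHom (k n : ℕ) : PartitionAlgebra k →+ Module.End ℤ ((ℕ → Fin n) → ℤ) :=
  (Finsupp.liftAddHom fun ρ =>
    { toFun := fun c => c.eval (n : ℤ) • ρ.act n
      map_zero' := by simp
      map_add' := fun c d => by rw [eval_add, add_smul] } :
    (Diagram k →₀ ℤ[X]) →+ Module.End ℤ ((ℕ → Fin n) → ℤ))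

theorem actAddHom_apply {k n : ℕ} (x : PartitionAlgebra k) :
    actAddHom k n x = ((basis k).repr x).sum fun ρ c => c.eval (n : ℤ) • ρ.act n := rfl

theorem actAddHom_smul_basis {k n : ℕ} (c : ℤ[X]) (ρ : Diagram k) :
    actAddHom k n (c • basis k ρ) = c.eval (n : ℤ) • ρ.act n := by
  rw [actAddHom_apply, map_smul, Module.Basis.repr_self, Finsupp.smul_single, smul_eq_mul,
    mul_one, Finsupp.sum_single_index (by simp)]

theorem actAddHom_mul {k n : ℕ} (x y : PartitionAlgebra k) :
    actAddHom k n (x * y) = actAddHom k n x * actAddHom k n y := by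
  induction x using induction_linear with
  | zero => simp
  | add a b ha hb => rw [add_mul, map_add, map_add, add_mul, ha, hb]
  | smul_basis c ρ =>
    induction y using induction_linear with
    | zero => simp
    | add a b ha hb => rw [mul_add, map_add, map_add, mul_add, ha, hb]
    | smul_basis d τ =>
      rw [smul_mul_smul_comm, basis_mul_basis, smul_smul, actAddHom_smul_basis,
        actAddHom_smul_basis, actAddHom_smul_basis, smul_mul_smul_comm, Diagram.act_mul_act,
        smul_smul]
      simp

theorem actAddHom_basis {k n : ℕ} (ρ : Diagram k) : actAddHom k n (basis k ρ) = ρ.act n := by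
  have h := actAddHom_smul_basis (n := n) 1 ρ
  rwa [one_smul, eval_one, one_smul] at h

theorem Diagram.act_id (k n : ℕ) : (Diagram.id k).act n = 1 := by
  classical
  refine LinearMap.ext fun F => funext fun f => ?_
  rw [Diagram.act_apply, Finset.sum_eq_single (f ∘ label)]
  · rw [if_pos, recolor_eq (g := f ∘ label) (f' := f) (fun _ => rfl) fun _ _ => rfl]
    · rfl
    · rintro (a | a) (b | b) h <;> exact congrArg f h
  · intro g _ hg
    refine if_neg fun h => hg (funext fun a => ?_)
    exact (@h (Sum.inl a) (Sum.inr a) rfl).symm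
  · exact fun h => absurd (Finset.mem_univ _) h

theorem actAddHom_one {k n : ℕ} : actAddHom k n 1 = 1 := by
  rw [one_eq_basis, actAddHom_basis, Diagram.act_id]

/-- The actions with all numbers of colors are jointly faithful. -/
theorem eq_zero_of_actAddHom {k : ℕ} {x : PartitionAlgebra k} (h : ∀ n, actAddHom k n x = 0) :
    x = 0 := by
  classical
  by_contra hx
  have hne : ((basis k).repr x).support.Nonempty := by
    rw [Finsupp.support_nonempty_iff]
    simpa using hx
  -- At a coloring whose color classes are exactly the blocks of `ρ`, a diagram `τ` contributes only
  -- if `τ ≤ ρ`. Minimality of `ρ` in the support leaves its own coefficient alone, which therefore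
  -- vanishes at every large enough `n`.
  obtain ⟨ρ, hρ⟩ := Finset.exists_minimal hne
  have hroot : ∀ m : ℕ, ((basis k).repr x ρ).eval ((Nat.card (Quotient ρ) + 1 + m : ℕ) : ℤ) = 0 := by
    intro m
    -- There are enough colors to give distinct blocks distinct colors; the extra 1 keeps `n`
    -- positive even when there are no blocks, so that the filler coloring `f₀` exists.
    set n := Nat.card (Quotient ρ) + 1 + m with hn
    have hn0 : 0 < n := by omega
    let e : Quotient ρ → Fin n := fun q => Fin.castLE (by omega) (Finite.equivFin (Quotient ρ) q)
    have he : Function.Injective e := fun a b hab => by simpa [e] using hab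
    let c : Vertex k → Fin n := fun v => e (Quotient.mk ρ v)
    have hc : Setoid.ker c = ρ := by
      ext v w
      rw [Setoid.ker_def]
      exact he.eq_iff.trans Quotient.eq
    let f₀ : ℕ → Fin n := fun _ => ⟨0, hn0⟩
    have h0 := congrFun (LinearMap.congr_fun (h n) fun f => if f ∘ label = c ∘ Sum.inr then 1 else 0)
      (recolor f₀ (c ∘ Sum.inl))
    simp only [actAddHom_apply, Finsupp.sum, LinearMap.sum_apply, Finset.sum_apply,
      LinearMap.smul_apply, Pi.smul_apply, Diagram.act_indicator, hc] at h0
    rw [Finset.sum_eq_single ρ] at h0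
    · simpa using h0
    · intro τ hτ hne
      rw [if_neg fun hle => hne (le_antisymm hle (hρ.le_of_le hτ hle)), smul_zero]
    · intro hn'
      exact absurd hρ.prop hn'
  refine Finsupp.mem_support_iff.1 hρ.prop (Polynomial.eq_zero_of_infinite_isRoot _ ?_)
  refine Set.infinite_of_injective_forall_mem (f := fun m : ℕ =>
    ((Nat.card (Quotient ρ) + 1 + m : ℕ) : ℤ)) ?_ hroot
  intro a b hab
  simpa using hab

theorem eq_of_actAddHom {k : ℕ} {x y : PartitionAlgebra k}
    (h : ∀ n, actAddHom k n x = actAddHom k n y) : x = y :=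
  sub_eq_zero.1 (eq_zero_of_actAddHom fun n => by rw [map_sub, h, sub_self])

end PartitionAlgebra

/-! ### The action of the generators -/

theorem exists_label_iff {k j : ℕ} : (∃ a : Fin k, label a = j) ↔ 1 ≤ j ∧ j ≤ k := by
  constructor
  · rintro ⟨a, rfl⟩
    have := a.isLt
    simp only [label]
    omega
  · rintro ⟨h1, h2⟩
    exact ⟨⟨j - 1, by omega⟩, Nat.sub_add_cancel h1⟩

/-- A diagram that relates every bottom vertex to a top vertex acts by a substitution. -/
theorem Diagram.act_apply_of_iff {k n : ℕ} {ρ : Diagram k} {f f' : ℕ → Fin n} {P : Prop}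
    [Decidable P]
    (h : ∀ g : Fin k → Fin n, ρ ≤ Setoid.ker (Sum.elim (f ∘ label) g) ↔ P ∧ g = f' ∘ label)
    (hf : ∀ j, (∀ a : Fin k, label a ≠ j) → f j = f' j) (F : (ℕ → Fin n) → ℤ) :
    ρ.act n F f = if P then F f' else 0 := by
  rw [Diagram.act_apply, Finset.sum_eq_single (f' ∘ label)]
  · rw [recolor_eq (g := f' ∘ label) (fun _ => rfl) hf]
    simp only [h, and_true]
  · intro g _ hg
    rw [if_neg fun hle => hg ((h g).1 hle).2]
  · exact fun h => absurd (Finset.mem_univ _) h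

namespace PartitionAlgebra

variable {k n : ℕ}

theorem act_s {i : ℕ} (hi : 1 ≤ i) (hk : i + 1 ≤ k) (F : (ℕ → Fin n) → ℤ) (f : ℕ → Fin n) :
    actAddHom k n (s k i) F f = F (f ∘ Equiv.swap i (i + 1)) := by
  have hr : ∀ b : Fin k, ∃ a : Fin k, label a = Equiv.swap i (i + 1) (label b) := by
    intro b
    have hb := exists_label_iff.1 ⟨b, rfl⟩
    refine exists_label_iff.2 ?_
    rw [Equiv.swap_apply_def]
    split_ifs <;> omega
  rw [s, actAddHom_basis, Diagram.act_apply_of_iff (P := True)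
    (f' := f ∘ Equiv.swap i (i + 1)), if_pos trivial]
  · intro g
    rw [true_and]
    constructor
    · intro h
      funext b
      obtain ⟨a, ha⟩ := hr b
      have := @h (Sum.inl a) (Sum.inr b) (by simp [Setoid.ker_def, ha])
      simp only [Setoid.ker_def, Sum.elim_inl, Sum.elim_inr, Function.comp, ha] at this
      exact this.symm
    · rintro rfl v w hvw
      rw [Setoid.ker_def] at hvw ⊢
      have hv : ∀ v : Vertex k,
          Sum.elim (f ∘ label) ((f ∘ Equiv.swap i (i + 1)) ∘ label) v = f (Equiv.swap i (i + 1)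
            (Sum.elim (fun a => Equiv.swap i (i + 1) (label a)) (fun b => label b) v)) := by
        rintro (a | a) <;> simp
      rw [hv, hv, hvw]
  · intro j hj
    rw [Function.comp, Equiv.swap_apply_of_ne_of_ne]
    · rintro rfl
      exact not_exists.2 hj (exists_label_iff.2 (by omega))
    · rintro rfl
      exact not_exists.2 hj (exists_label_iff.2 (by omega))

theorem act_pHalf {i : ℕ} (hi : 1 ≤ i) (hk : i + 1 ≤ k) (F : (ℕ → Fin n) → ℤ) (f : ℕ → Fin n) :
    actAddHom k n (pHalf k i) F f = if f i = f (i + 1) then F f else 0 := by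
  rw [pHalf, actAddHom_basis, Diagram.act_apply_of_iff (P := f i = f (i + 1)) (f' := f)]
  · intro g
    constructor
    · intro h
      obtain ⟨x, hx⟩ := exists_label_iff.2 (⟨hi, by omega⟩ : 1 ≤ i ∧ i ≤ k)
      obtain ⟨y, hy⟩ := exists_label_iff.2 (⟨by omega, hk⟩ : 1 ≤ i + 1 ∧ i + 1 ≤ k)
      refine ⟨?_, funext fun a => ?_⟩
      · have := @h (Sum.inl x) (Sum.inl y) (by simp [Setoid.ker_def, vlabel, hx, hy])
        simpa [Setoid.ker_def, hx, hy] using this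
      · exact (@h (Sum.inl a) (Sum.inr a) rfl).symm
    · rintro ⟨hf, rfl⟩ v w hvw
      have hv : ∀ v : Vertex k, Sum.elim (f ∘ label) (f ∘ label) v =
          f (if vlabel v = i + 1 then i else vlabel v) := by
        intro v
        split_ifs with h
        · rw [hf, ← h]
          rcases v with a | a <;> rfl
        · rcases v with a | a <;> rfl
      rw [Setoid.ker_def] at hvw ⊢
      rw [hv, hv, hvw]
  · exact fun _ _ => rfl

theorem act_p {j : ℕ} (hj : 1 ≤ j) (hk : j ≤ k) (F : (ℕ → Fin n) → ℤ) (f : ℕ → Fin n) :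
    actAddHom k n (p k j) F f = ∑ d, F (Function.update f j d) := by
  classical
  obtain ⟨x, rfl⟩ := exists_label_iff.2 (⟨hj, hk⟩ : 1 ≤ j ∧ j ≤ k)
  -- The singleton block at the bottom vertex leaves `g x` free, while all other values of `g` are
  -- copied from `f`; the sum over `g` thus becomes a sum over one color.
  have h (g : Fin k → Fin n) : (Setoid.ker fun v : Vertex k =>
      if vlabel v = label x then (Sum.inl v : Vertex k ⊕ ℕ) else Sum.inr (vlabel v)) ≤
      Setoid.ker (Sum.elim (f ∘ label) g) ↔ g = Function.update (f ∘ label) x (g x) := by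
    constructor
    · intro h
      funext a
      rcases eq_or_ne a x with rfl | ha
      · rw [Function.update_self]
      · rw [Function.update_of_ne ha]
        exact (@h (Sum.inl a) (Sum.inr a)
          (by simp [Setoid.ker_def, vlabel, label_injective.eq_iff, ha])).symm
    · intro hg v w hvw
      have hg' : ∀ a, a ≠ x → g a = f (label a) := fun a ha => by
        rw [hg, Function.update_of_ne ha]; rfl
      rw [Setoid.ker_def] at hvw ⊢
      split_ifs at hvw with h1 h2 h2
      · rw [Sum.inl.inj hvw]
      · have hv : ∀ v : Vertex k, vlabel v ≠ label x →
            Sum.elim (f ∘ label) g v = f (vlabel v) := by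
          rintro (a | a) ha
          · rfl
          · exact hg' a fun h => ha (h ▸ rfl)
        rw [hv v h1, hv w h2, Sum.inr.inj hvw]
  rw [p, actAddHom_basis, Diagram.act_apply]
  simp only [h]
  rw [← Finset.sum_filter]
  refine Finset.sum_nbij' (fun g => g x) (fun d => Function.update (f ∘ label) x d)
    (fun _ _ => Finset.mem_univ _) (fun d _ => by simp) ?_ (fun d _ => by simp) ?_
  · intro g hg
    exact (Finset.mem_filter.1 hg).2.symm
  · intro g hg
    have hg' := (Finset.mem_filter.1 hg).2
    congr 1
    refine recolor_eq (fun a => ?_) fun j hj => (Function.update_of_ne (hj x).symm _ _).symm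
    rw [hg']
    simp [Function.update_apply, label_injective.eq_iff]

/-! ### The action of the Jucys-Murphy elements -/

/-- The coloring `f` with the colors `a` and `b` exchanged at the labels `1, …, m`. -/
def swapColors (m : ℕ) (a b : Fin n) (f : ℕ → Fin n) (j : ℕ) : Fin n :=
  if 1 ≤ j ∧ j ≤ m then Equiv.swap a b (f j) else f j

theorem swapColors_of_lt {m j : ℕ} (h : m < j) (a b : Fin n) (f : ℕ → Fin n) :
    swapColors m a b f j = f j := if_neg (by omega)

theorem swapColors_of_le {m j : ℕ} (h1 : 1 ≤ j) (h : j ≤ m) (a b : Fin n) (f : ℕ → Fin n) :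
    swapColors m a b f j = Equiv.swap a b (f j) := if_pos ⟨h1, h⟩

theorem swapColors_same (m : ℕ) (a : Fin n) (f : ℕ → Fin n) : swapColors m a a f = f := by
  funext j
  simp [swapColors]

theorem swapColors_zero (a b : Fin n) (f : ℕ → Fin n) : swapColors 0 a b f = f := by
  funext j
  exact if_neg (by omega)

theorem swapColors_succ_of_ne {m : ℕ} {a b : Fin n} {f : ℕ → Fin n} (ha : f (m + 1) ≠ a)
    (hb : f (m + 1) ≠ b) : swapColors (m + 1) a b f = swapColors m a b f := by
  funext j
  simp only [swapColors, Equiv.swap_apply_def]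
  grind

/-- Conjugation by the two transpositions moves the exchanged colors to `f (m + 2)` and `f (m + 3)`,
but leaves the label `m + 1` untouched. This is wrong only if `f (m + 1)` is one of those two
colors. The four correction terms are supported on precisely these cases, and replace the exchange
at `1, …, m` by the exchange at `1, …, m + 1`. -/
theorem act_σHalf_succ {m : ℕ} (hk : m + 3 ≤ k)
    (hL : ∀ (F : (ℕ → Fin n) → ℤ) (f : ℕ → Fin n),
      actAddHom k n (L k (m + 1)) F f = ∑ a, F (swapColors (m + 1) a (f (m + 1)) f))
    (hσ : ∀ (F : (ℕ → Fin n) → ℤ) (f : ℕ → Fin n),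
      actAddHom k n (σHalf k (m + 1)) F f = F (swapColors m (f (m + 1)) (f (m + 2)) f))
    (F : (ℕ → Fin n) → ℤ) (f : ℕ → Fin n) :
    actAddHom k n (σHalf k (m + 2)) F f = F (swapColors (m + 1) (f (m + 2)) (f (m + 3)) f) := by
  have s1 := act_s (k := k) (n := n) (i := m + 1) (by omega) (by omega)
  have s2 := act_s (k := k) (n := n) (i := m + 2) (by omega) (by omega)
  have h1 := act_pHalf (k := k) (n := n) (i := m + 1) (by omega) (by omega)
  have h2 := act_pHalf (k := k) (n := n) (i := m + 2) (by omega) (by omega)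
  have p2 := act_p (k := k) (n := n) (j := m + 2) (by omega) (by omega)
  have e1 : Equiv.swap (m + 1) (m + 2) (m + 3) = m + 3 :=
    Equiv.swap_apply_of_ne_of_ne (by omega) (by omega)
  have e2 : Equiv.swap (m + 2) (m + 3) (m + 1) = m + 1 :=
    Equiv.swap_apply_of_ne_of_ne (by omega) (by omega)
  have c1 (a b : Fin n) (f) : swapColors (m + 1) a b f (m + 1) = Equiv.swap a b (f (m + 1)) :=
    swapColors_of_le (by omega) le_rfl _ _ _
  have c2 (a b : Fin n) (f) : swapColors (m + 1) a b f (m + 2) = f (m + 2) :=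
    swapColors_of_lt (by omega) _ _ _
  have c3 (a b : Fin n) (f) : swapColors (m + 1) a b f (m + 3) = f (m + 3) :=
    swapColors_of_lt (by omega) _ _ _
  have t1 : actAddHom k n (s k (m + 1) * s k (m + 2) * σHalf k (m + 1) * s k (m + 2) * s k (m + 1))
      F f = F (swapColors m (f (m + 2)) (f (m + 3)) f) := by
    simp only [actAddHom_mul, Module.End.mul_apply, s1, s2, hσ]
    refine congrArg F (funext fun j => ?_)
    simp only [swapColors, Function.comp, Equiv.swap_apply_def]
    grind
  have t2 : actAddHom k n (pHalf k (m + 1) * L k (m + 1) * s k (m + 2) * pHalf k (m + 1)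
      * s k (m + 2)) F f = if f (m + 1) = f (m + 2) then
        F (swapColors (m + 1) (f (m + 2)) (f (m + 3)) f) else 0 := by
    simp [actAddHom_mul, Module.End.mul_apply, s2, h1, hL, e2, c1, c3]
    split_ifs with h
    · refine congrArg F (funext fun j => ?_)
      simp only [swapColors, Function.comp, Equiv.swap_apply_def]
      grind
    · rfl
  have t3 : actAddHom k n (s k (m + 2) * pHalf k (m + 1) * L k (m + 1) * s k (m + 2)
      * pHalf k (m + 1)) F f = if f (m + 1) = f (m + 3) then
        F (swapColors (m + 1) (f (m + 2)) (f (m + 3)) f) else 0 := by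
    simp [actAddHom_mul, Module.End.mul_apply, s2, h1, hL, e2, c1, c3]
    split_ifs with h
    · refine congrArg F (funext fun j => ?_)
      simp only [swapColors, Function.comp, Equiv.swap_apply_def]
      grind
    · rfl
  have t4 : actAddHom k n (pHalf k (m + 1) * L k (m + 1) * s k (m + 1) * pHalf k (m + 2)
      * p k (m + 2) * pHalf k (m + 1)) F f = if f (m + 1) = f (m + 2) then
        F (swapColors m (f (m + 2)) (f (m + 3)) f) else 0 := by
    simp [actAddHom_mul, Module.End.mul_apply, s1, h1, h2, p2, hL, e1, c1, c2, c3]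
    split_ifs with h
    · refine congrArg F (funext fun j => ?_)
      simp only [swapColors, Function.comp, Equiv.swap_apply_def, Function.update_apply]
      grind
    · rfl
  have t5 : actAddHom k n (s k (m + 2) * pHalf k (m + 1) * p k (m + 2) * pHalf k (m + 2)
      * s k (m + 1) * L k (m + 1) * pHalf k (m + 1) * s k (m + 2)) F f =
      if f (m + 1) = f (m + 3) then F (swapColors m (f (m + 2)) (f (m + 3)) f) else 0 := by
    simp [actAddHom_mul, Module.End.mul_apply, s1, s2, h1, h2, p2, hL, e2, c1, c2]
    split_ifs with h
    · refine congrArg F (funext fun j => ?_)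
      simp only [swapColors, Function.comp, Equiv.swap_apply_def, Function.update_apply]
      grind
    · rfl
  rw [σHalf]
  simp only [map_add, map_sub, LinearMap.add_apply, LinearMap.sub_apply, Pi.add_apply,
    Pi.sub_apply, t1, t2, t3, t4, t5]
  -- If both equalities hold, all exchanges are trivial and the five terms add up to `1 + 1 + 1 - 1
  -- - 1 = 1` copy of `F f`.
  by_cases hx : f (m + 1) = f (m + 2)
  · by_cases hy : f (m + 1) = f (m + 3)
    · rw [if_pos hx, if_pos hy, if_pos hx, if_pos hy, ← hx, ← hy, swapColors_same, swapColors_same]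
      ring
    · rw [if_pos hx, if_neg hy, if_pos hx, if_neg hy]
      ring
  · by_cases hy : f (m + 1) = f (m + 3)
    · rw [if_neg hx, if_pos hy, if_neg hx, if_pos hy]
      ring
    · rw [if_neg hx, if_neg hy, if_neg hx, if_neg hy, swapColors_succ_of_ne hx hy]
      ring

/-- In the action, `σ_{i+1} = s_i σ_{i+1/2}` with `i = m + 2`. Multiplying the recursion for
`σ_{i+1/2}` by `s_i` on the left gives the four correction terms of `σ_{i+1}` verbatim, since `s_i`
squares to the identity. -/
theorem act_σ_succ {m : ℕ} (hk : m + 3 ≤ k)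
    (hσ : ∀ (F : (ℕ → Fin n) → ℤ) (f : ℕ → Fin n),
      actAddHom k n (σ k (m + 2)) F f = F (swapColors (m + 2) (f (m + 1)) (f (m + 2)) f))
    (hσ' : ∀ (F : (ℕ → Fin n) → ℤ) (f : ℕ → Fin n),
      actAddHom k n (σHalf k (m + 1)) F f = F (swapColors m (f (m + 1)) (f (m + 2)) f))
    (F : (ℕ → Fin n) → ℤ) (f : ℕ → Fin n) :
    actAddHom k n (σ k (m + 3)) F f =
      actAddHom k n (σHalf k (m + 2)) F (f ∘ Equiv.swap (m + 2) (m + 3)) := by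
  have s1 := act_s (k := k) (n := n) (i := m + 1) (by omega) (by omega)
  have s2 := act_s (k := k) (n := n) (i := m + 2) (by omega) (by omega)
  have hs : (f ∘ Equiv.swap (m + 2) (m + 3)) ∘ Equiv.swap (m + 2) (m + 3) = f := by
    funext j
    simp
  rw [σ_succ k (m + 2) (by omega), σHalf, show m + 2 - 1 = m + 1 from rfl]
  simp only [map_add, map_sub, LinearMap.add_apply, LinearMap.sub_apply, Pi.add_apply,
    Pi.sub_apply, actAddHom_mul, Module.End.mul_apply, s1, s2, hσ, hσ', hs]
  -- Only the leading conjugates of `σ_i` and `σ_{i-1/2}` remain to be compared.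
  congr 4
  refine congrArg F (funext fun j => ?_)
  simp only [swapColors, Function.comp, Equiv.swap_apply_def]
  grind

/-- `L_{i+1}` acts by exchanging the color at `i + 1` with all the colors. -/
theorem act_L_succ {i : ℕ} (hi : 1 ≤ i) (hk : i + 1 ≤ k)
    (hL : ∀ (F : (ℕ → Fin n) → ℤ) (f : ℕ → Fin n),
      actAddHom k n (L k i) F f = ∑ a, F (swapColors i a (f i) f))
    (hσ : ∀ (F : (ℕ → Fin n) → ℤ) (f : ℕ → Fin n),
      actAddHom k n (σ k (i + 1)) F f = F (swapColors (i + 1) (f i) (f (i + 1)) f))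
    (F : (ℕ → Fin n) → ℤ) (f : ℕ → Fin n) :
    actAddHom k n (L k (i + 1)) F f = ∑ a, F (swapColors (i + 1) a (f (i + 1)) f) := by
  have s1 := act_s (k := k) (n := n) hi hk
  have h1 := act_pHalf (k := k) (n := n) hi hk
  have p2 := act_p (k := k) (n := n) (j := i + 1) (by omega) (by omega)
  have c1 (a b : Fin n) (f) : swapColors i a b f i = Equiv.swap a b (f i) :=
    swapColors_of_le hi le_rfl _ _ _
  have c2 (a b : Fin n) (f) : swapColors i a b f (i + 1) = f (i + 1) :=
    swapColors_of_lt (by omega) _ _ _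
  rw [L_succ k i hi]
  simp only [map_add, map_sub, map_neg, LinearMap.add_apply, LinearMap.sub_apply, Pi.add_apply,
    LinearMap.neg_apply, Pi.neg_apply, actAddHom_mul, Module.End.mul_apply, s1,
    Pi.sub_apply, h1, p2, hL, hσ]
  simp [c1, c2]
  -- When the two colors agree, the terms `p L s` and `s L s` cancel, `s L p` cancels `σ`, and the
  -- term with four factors is the answer.
  by_cases h : f i = f (i + 1)
  · have hs : f ∘ Equiv.swap i (i + 1) = f := by
      funext j
      simp only [Function.comp, Equiv.swap_apply_def]
      grind
    have hr (x : Fin n) : Function.update (swapColors i x (f (i + 1)) f) (i + 1) x =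
        swapColors (i + 1) x (f (i + 1)) f := by
      funext j
      simp only [swapColors, Function.update_apply, Equiv.swap_apply_def]
      grind
    simp only [h, if_true, hs, hr, swapColors_same]
    ring
  -- The conjugate `s L s` skips the label `i`, which matters only for the color `x = f i`. That
  -- single wrong summand is removed by `s L p`, and the right one is supplied by `σ`; the terms
  -- beginning with `pHalf` vanish.
  · have hr (x : Fin n) : F (swapColors i x (f (i + 1)) (f ∘ Equiv.swap i (i + 1)) ∘
        Equiv.swap i (i + 1)) = F (swapColors (i + 1) x (f (i + 1)) f) +
        if x = f i then F (swapColors i (f i) (f (i + 1)) (f ∘ Equiv.swap i (i + 1))) -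
          F (swapColors (i + 1) (f i) (f (i + 1)) f) else 0 := by
      split_ifs with hx
      · rw [hx, add_sub_cancel]
        refine congrArg F (funext fun j => ?_)
        simp only [swapColors, Function.comp, Equiv.swap_apply_def]
        grind
      · rw [add_zero]
        refine congrArg F (funext fun j => ?_)
        simp only [swapColors, Function.comp, Equiv.swap_apply_def]
        grind
    simp only [h, if_false, hr, Finset.sum_add_distrib, Finset.sum_ite_eq',
      Finset.mem_univ, if_true]
    ring

/-- The conjugate of the previous element skips the label `i + 1`. If `f (i + 1) = f (i + 2)`, its
sum cancels against the term with four factors and `- p L` gives the required sum. Otherwise the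
skipped label matters only for `a = f (i + 1)`, and `- L p` together with `σHalf` repairs that
summand. -/
theorem act_LHalf_succ {i : ℕ} (hk : i + 2 ≤ k)
    (hL : ∀ (F : (ℕ → Fin n) → ℤ) (f : ℕ → Fin n),
      actAddHom k n (L k (i + 1)) F f = ∑ a, F (swapColors (i + 1) a (f (i + 1)) f))
    (hσ : ∀ (F : (ℕ → Fin n) → ℤ) (f : ℕ → Fin n),
      actAddHom k n (σHalf k (i + 1)) F f = F (swapColors i (f (i + 1)) (f (i + 2)) f))
    (hH : ∀ (F : (ℕ → Fin n) → ℤ) (f : ℕ → Fin n), actAddHom k n (LHalf k i) F f =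
      n * F f - ∑ a, F (swapColors i a (f (i + 1)) f))
    (F : (ℕ → Fin n) → ℤ) (f : ℕ → Fin n) :
    actAddHom k n (LHalf k (i + 1)) F f =
      n * F f - ∑ a, F (swapColors (i + 1) a (f (i + 2)) f) := by
  have s1 (F : (ℕ → Fin n) → ℤ) (f : ℕ → Fin n) :
      actAddHom k n (s k (i + 1)) F f = F (f ∘ Equiv.swap (i + 1) (i + 2)) :=
    act_s (by omega) hk F f
  have h1 (F : (ℕ → Fin n) → ℤ) (f : ℕ → Fin n) :
      actAddHom k n (pHalf k (i + 1)) F f = if f (i + 1) = f (i + 2) then F f else 0 :=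
    act_pHalf (by omega) hk F f
  have p1 := act_p (k := k) (n := n) (j := i + 1) (by omega) (by omega)
  have c1 (a b : Fin n) (f) : swapColors (i + 1) a b f (i + 1) = Equiv.swap a b (f (i + 1)) :=
    swapColors_of_le (by omega) le_rfl _ _ _
  have c2 (a b : Fin n) (f) : swapColors (i + 1) a b f (i + 2) = f (i + 2) :=
    swapColors_of_lt (by omega) _ _ _
  rw [LHalf]
  simp only [map_add, map_sub, map_neg, LinearMap.add_apply, LinearMap.sub_apply, Pi.add_apply,
    LinearMap.neg_apply, Pi.neg_apply, actAddHom_mul, Module.End.mul_apply, s1,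
    Pi.sub_apply, h1, p1, hL, hσ, hH]
  simp [c1, c2]
  have hs : (f ∘ Equiv.swap (i + 1) (i + 2)) ∘ Equiv.swap (i + 1) (i + 2) = f := by
    funext j
    simp
  have ht (x : Fin n) : swapColors i x (f (i + 2)) (f ∘ Equiv.swap (i + 1) (i + 2)) ∘
      Equiv.swap (i + 1) (i + 2) = swapColors i x (f (i + 2)) f := by
    funext j
    simp only [swapColors, Function.comp, Equiv.swap_apply_def]
    grind
  simp only [hs, ht]
  by_cases h : f (i + 1) = f (i + 2)
  · have hr (x : Fin n) : Function.update (swapColors (i + 1) x (f (i + 2)) f) (i + 1) (f (i + 2)) =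
        swapColors i x (f (i + 2)) f := by
      funext j
      simp only [swapColors, Function.update_apply, Equiv.swap_apply_def]
      grind
    rw [if_pos h, if_pos h]
    rw [h]
    simp only [hr, swapColors_same]
    ring
  · have hr (x : Fin n) : F (swapColors i x (f (i + 2)) f) =
        F (swapColors (i + 1) x (f (i + 2)) f) +
        if x = f (i + 1) then F (swapColors i (f (i + 1)) (f (i + 2)) f) -
          F (swapColors (i + 1) (f (i + 2)) (f (i + 1)) f) else 0 := by
      split_ifs with hx
      · rw [hx]
        have hc : swapColors (i + 1) (f (i + 2)) (f (i + 1)) f =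
            swapColors (i + 1) (f (i + 1)) (f (i + 2)) f := by
          funext j
          rw [swapColors, swapColors, Equiv.swap_comm]
        rw [hc, add_sub_cancel]
      · rw [add_zero, swapColors_succ_of_ne (Ne.symm hx) h]
    rw [if_neg h, if_neg h, Finset.sum_congr rfl fun x _ => hr x, Finset.sum_add_distrib,
      Finset.sum_ite_eq', if_pos (Finset.mem_univ _)]
    ring

/-- The three formulas need one joint induction: the step for `σHalf` uses `L`, the step for `L`
uses `σ`, and the step for `σ` uses the new `σHalf`. -/
theorem act_σHalf_and_L_and_σ (i : ℕ) (hk : i + 2 ≤ k) :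
    (∀ (F : (ℕ → Fin n) → ℤ) (f : ℕ → Fin n),
      actAddHom k n (σHalf k (i + 1)) F f = F (swapColors i (f (i + 1)) (f (i + 2)) f)) ∧
    (∀ (F : (ℕ → Fin n) → ℤ) (f : ℕ → Fin n),
      actAddHom k n (L k (i + 1)) F f = ∑ a, F (swapColors (i + 1) a (f (i + 1)) f)) ∧
    (∀ (F : (ℕ → Fin n) → ℤ) (f : ℕ → Fin n),
      actAddHom k n (σ k (i + 2)) F f = F (swapColors (i + 2) (f (i + 1)) (f (i + 2)) f)) := by
  induction i with
  | zero =>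
    refine ⟨fun F f => ?_, fun F f => ?_, fun F f => ?_⟩
    · rw [σHalf, actAddHom_one, swapColors_zero]
      rfl
    · rw [L_one, act_p le_rfl (by omega)]
      refine Finset.sum_congr rfl fun a _ => congrArg F (funext fun j => ?_)
      simp only [swapColors, Function.update_apply, Equiv.swap_apply_def]
      grind
    · rw [σ_two, act_s le_rfl (by omega)]
      refine congrArg F (funext fun j => ?_)
      simp only [swapColors, Function.comp, Equiv.swap_apply_def]
      grind
  | succ m ih =>
    obtain ⟨h1, h2, h3⟩ := ih (by omega)
    have h4 := act_σHalf_succ hk h2 h1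
    refine ⟨h4, act_L_succ (by omega) (by omega) h2 h3, fun F f => ?_⟩
    rw [act_σ_succ hk h3 h1, h4]
    refine congrArg F (funext fun j => ?_)
    simp only [swapColors, Function.comp, Equiv.swap_apply_def]
    grind

theorem act_σHalf {i : ℕ} (hk : i + 2 ≤ k) (F : (ℕ → Fin n) → ℤ) (f : ℕ → Fin n) :
    actAddHom k n (σHalf k (i + 1)) F f = F (swapColors i (f (i + 1)) (f (i + 2)) f) :=
  (act_σHalf_and_L_and_σ i hk).1 F f

/-- `L_i` acts by exchanging the color at `i` with all the colors. -/
theorem act_L {i : ℕ} (hi : 1 ≤ i) (hk : i + 1 ≤ k) (F : (ℕ → Fin n) → ℤ) (f : ℕ → Fin n) :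
    actAddHom k n (L k i) F f = ∑ a, F (swapColors i a (f i) f) := by
  obtain ⟨m, rfl⟩ := Nat.exists_eq_add_of_le' hi
  exact (act_σHalf_and_L_and_σ m hk).2.1 F f

/-- The joint induction also treats `σHalf`, which needs one more label, and so stops before `L k
k`; one further application of `act_L_succ` reaches it. -/
theorem act_L_add_one {i : ℕ} (hi : 1 ≤ i) (hk : i + 1 ≤ k) (F : (ℕ → Fin n) → ℤ)
    (f : ℕ → Fin n) :
    actAddHom k n (L k (i + 1)) F f = ∑ a, F (swapColors (i + 1) a (f (i + 1)) f) := by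
  obtain ⟨m, rfl⟩ := Nat.exists_eq_add_of_le' hi
  obtain ⟨-, h2, h3⟩ := act_σHalf_and_L_and_σ (n := n) m hk
  exact act_L_succ hi hk h2 h3 F f

/-- `L_{i + 1/2}` acts by exchanging the color at `i + 1` with all the colors, at the labels
`1, …, i`. -/
theorem act_LHalf {i : ℕ} (hk : i + 1 ≤ k) (F : (ℕ → Fin n) → ℤ) (f : ℕ → Fin n) :
    actAddHom k n (LHalf k i) F f = n * F f - ∑ a, F (swapColors i a (f (i + 1)) f) := by
  induction i generalizing F f with
  | zero => simp [LHalf, swapColors_zero]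
  | succ m ih =>
    exact act_LHalf_succ hk (act_L (by omega) hk) (act_σHalf hk) (ih (by omega)) F f

/-! ### Commutation -/

theorem swapColors_update {m j : ℕ} (h1 : 1 ≤ j) (hm : j ≤ m) (a b d : Fin n) (f : ℕ → Fin n) :
    swapColors m a b (Function.update f j d) =
      Function.update (swapColors m a b f) j (Equiv.swap a b d) := by
  funext l
  simp only [swapColors, Function.update_apply]
  grind

theorem swapColors_comp_swap {m j : ℕ} (h1 : 1 ≤ j) (hm : j + 1 ≤ m) (a b : Fin n)
    (f : ℕ → Fin n) :
    swapColors m a b (f ∘ Equiv.swap j (j + 1)) = swapColors m a b f ∘ Equiv.swap j (j + 1) := by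
  funext l
  simp only [swapColors, Function.comp, Equiv.swap_apply_def j]
  grind

theorem swapColors_apply_eq_iff {m j : ℕ} (h1 : 1 ≤ j) (hm : j + 1 ≤ m) (a b : Fin n)
    (f : ℕ → Fin n) :
    swapColors m a b f j = swapColors m a b f (j + 1) ↔ f j = f (j + 1) := by
  rw [swapColors_of_le h1 (by omega), swapColors_of_le (by omega) hm, EmbeddingLike.apply_eq_iff_eq]

/-- Recoloring at `j` does not affect the color at `l`, and the exchange merely permutes the new
color `d`, over which the sum runs. -/
theorem sum_swapColors_update {m j l : ℕ} (h1 : 1 ≤ j) (hm : j ≤ m) (hl : j ≠ l)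
    (F : (ℕ → Fin n) → ℤ) (f : ℕ → Fin n) :
    ∑ d, ∑ a, F (swapColors m a (Function.update f j d l) (Function.update f j d)) =
      ∑ a, ∑ d, F (Function.update (swapColors m a (f l) f) j d) := by
  rw [Finset.sum_comm]
  refine Finset.sum_congr rfl fun a _ => ?_
  simp only [Function.update_of_ne hl.symm, swapColors_update h1 hm]
  exact Equiv.sum_comp (Equiv.swap a (f l)) fun d => F (Function.update (swapColors m a (f l) f) j d)

theorem L_mul_p {i j : ℕ} (hi : 1 ≤ i) (hk : i + 1 ≤ k) (hj : 1 ≤ j) (hji : j ≤ i) :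
    L k (i + 1) * p k j = p k j * L k (i + 1) := by
  refine eq_of_actAddHom fun n => LinearMap.ext fun F => funext fun f => ?_
  simp only [actAddHom_mul, Module.End.mul_apply, act_p hj (show j ≤ k by omega),
    act_L_add_one hi hk]
  exact (sum_swapColors_update hj (by omega) (by omega) F f).symm

theorem L_mul_s {i j : ℕ} (hk : i + 1 ≤ k) (hj : 1 ≤ j) (hji : j + 1 ≤ i) :
    L k (i + 1) * s k j = s k j * L k (i + 1) := by
  refine eq_of_actAddHom fun n => LinearMap.ext fun F => funext fun f => ?_
  have hs : Equiv.swap j (j + 1) (i + 1) = i + 1 :=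
    Equiv.swap_apply_of_ne_of_ne (by omega) (by omega)
  simp only [actAddHom_mul, Module.End.mul_apply, act_s hj (show j + 1 ≤ k by omega),
    act_L_add_one (show 1 ≤ i by omega) hk, swapColors_comp_swap hj (show j + 1 ≤ i + 1 by omega),
    Function.comp_apply, hs]

/-- `pHalf` only tests an equality of colors, which the exchange preserves, and changes no color.
Hence `j = i` is allowed here, whereas `L_mul_s` must keep the label `i + 1` fixed. -/
theorem L_mul_pHalf {i j : ℕ} (hk : i + 1 ≤ k) (hj : 1 ≤ j) (hji : j ≤ i) :
    L k (i + 1) * pHalf k j = pHalf k j * L k (i + 1) := by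
  refine eq_of_actAddHom fun n => LinearMap.ext fun F => funext fun f => ?_
  simp only [actAddHom_mul, Module.End.mul_apply, act_pHalf hj (show j + 1 ≤ k by omega),
    act_L_add_one (hj.trans hji) hk, swapColors_apply_eq_iff hj (show j + 1 ≤ i + 1 by omega)]
  split_ifs
  · rfl
  · exact Finset.sum_const_zero

/-- When `f i = f (i + 1)`, the exchange at `1, …, i` gives the label `i` the color `a`. Then `p`
makes the color at `i + 1` arbitrary and the last `pHalf` forces it to be `a`, so that the exchange
is extended to `i + 1`. -/
theorem pHalf_mul_L {i : ℕ} (hi : 1 ≤ i) (hk : i + 1 ≤ k) :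
    pHalf k i * L k (i + 1) = pHalf k i * L k i * p k (i + 1) * pHalf k i := by
  refine eq_of_actAddHom fun n => LinearMap.ext fun F => funext fun f => ?_
  have hc (a b : Fin n) (f : ℕ → Fin n) : swapColors i a b f i = Equiv.swap a b (f i) :=
    swapColors_of_le hi le_rfl _ _ _
  simp only [actAddHom_mul, Module.End.mul_apply, act_pHalf hi hk, act_L_add_one hi hk,
    act_L hi hk, act_p (show 1 ≤ i + 1 by omega) hk, Function.update_self,
    Function.update_of_ne (show i ≠ i + 1 by omega), hc, Equiv.swap_apply_right,
    Finset.sum_ite_eq, Finset.mem_univ, if_true]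
  split_ifs with h
  · refine Finset.sum_congr rfl fun a _ => congrArg F (funext fun j => ?_)
    simp only [swapColors, Function.update_apply, Equiv.swap_apply_def]
    grind
  · rfl

theorem LHalf_mul_p {i j : ℕ} (hk : i + 1 ≤ k) (hj : 1 ≤ j) (hji : j ≤ i) :
    LHalf k i * p k j = p k j * LHalf k i := by
  refine eq_of_actAddHom fun n => LinearMap.ext fun F => funext fun f => ?_
  simp only [actAddHom_mul, Module.End.mul_apply, act_p hj (show j ≤ k by omega), act_LHalf hk,
    Finset.sum_sub_distrib, Finset.mul_sum]
  rw [sum_swapColors_update hj hji (by omega)]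

theorem LHalf_mul_s {i j : ℕ} (hk : i + 1 ≤ k) (hj : 1 ≤ j) (hji : j + 1 ≤ i) :
    LHalf k i * s k j = s k j * LHalf k i := by
  refine eq_of_actAddHom fun n => LinearMap.ext fun F => funext fun f => ?_
  have hs : Equiv.swap j (j + 1) (i + 1) = i + 1 :=
    Equiv.swap_apply_of_ne_of_ne (by omega) (by omega)
  simp only [actAddHom_mul, Module.End.mul_apply, act_s hj (show j + 1 ≤ k by omega),
    act_LHalf hk, swapColors_comp_swap hj hji, Function.comp_apply, hs]

/-- The exchange stops at the label `i`, so both labels compared by `pHalf` must be at most `i` for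
their equality to be preserved. -/
theorem LHalf_mul_pHalf {i j : ℕ} (hk : i + 1 ≤ k) (hj : 1 ≤ j) (hji : j + 1 ≤ i) :
    LHalf k i * pHalf k j = pHalf k j * LHalf k i := by
  refine eq_of_actAddHom fun n => LinearMap.ext fun F => funext fun f => ?_
  simp only [actAddHom_mul, Module.End.mul_apply, act_pHalf hj (show j + 1 ≤ k by omega),
    act_LHalf hk, swapColors_apply_eq_iff hj hji]
  split_ifs
  · rfl
  · simp

end PartitionAlgebra

end

end PartitionAlg

open PartitionAlg PartitionAlgebra in
theorem mainTheorem7 (k : ℕ) :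
    (∀ i, 1 ≤ i → i + 1 ≤ k →
      L k (i + 1) * pHalf k i = pHalf k i * L k (i + 1) ∧
      pHalf k i * L k (i + 1) = pHalf k i * L k i * p k (i + 1) * pHalf k i) ∧
    (∀ i, 1 ≤ i → i + 1 ≤ k → L k (i + 1) * p k i = p k i * L k (i + 1)) ∧
    (∀ i, 2 ≤ i → i + 1 ≤ k → L k (i + 1) * pHalf k (i - 1) = pHalf k (i - 1) * L k (i + 1)) ∧
    (∀ i, 2 ≤ i → i + 1 ≤ k → L k (i + 1) * s k (i - 1) = s k (i - 1) * L k (i + 1)) ∧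
    (∀ i, 2 ≤ i → i + 1 ≤ k → L k (i + 1) * p k (i - 1) = p k (i - 1) * L k (i + 1)) ∧
    (∀ i, 1 ≤ i → i + 1 ≤ k → LHalf k i * p k i = p k i * LHalf k i) ∧
    (∀ i, 2 ≤ i → i + 1 ≤ k → LHalf k i * pHalf k (i - 1) = pHalf k (i - 1) * LHalf k i) ∧
    (∀ i, 2 ≤ i → i + 1 ≤ k → LHalf k i * s k (i - 1) = s k (i - 1) * LHalf k i) ∧
    (∀ i, 2 ≤ i → i + 1 ≤ k → LHalf k i * p k (i - 1) = p k (i - 1) * LHalf k i) := by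
  refine ⟨fun i hi hk => ⟨L_mul_pHalf hk hi le_rfl, pHalf_mul_L hi hk⟩,
    fun i hi hk => L_mul_p hi hk hi le_rfl,
    fun i hi hk => L_mul_pHalf hk (by omega) (by omega),
    fun i hi hk => L_mul_s hk (by omega) (by omega),
    fun i hi hk => L_mul_p (by omega) hk (by omega) (by omega),
    fun i hi hk => LHalf_mul_p hk hi le_rfl,
    fun i hi hk => LHalf_mul_pHalf hk (by omega) (by omega),
    fun i hi hk => LHalf_mul_s hk (by omega) (by omega),
    fun i hi hk => LHalf_mul_p hk (by omega) (by omega)⟩
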